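/- For $\rho>1$ let $\mathcal{E}_\rho=\{(u+u^{-1})/2 : u\in\mathbb{C},\ |u|=\rho\}$ be the Bernstein ellipse (with foci $\pm1$ and major semi-axis $(\rho+\rho^{-1})/2$), and let $L(\mathcal{E}_\rho)$ be the length of its circumference. For $\lambda>-1/2$, $\lambda\neq0$, and an integer $n\ge0$ let $$C_n^\lambda(x)=\frac{(2\lambda)_n}{n!}\,{}_2F_1\!\left[-n,\,n+2\lambda;\ \lambda+\tfrac12;\ \tfrac{1-x}{2}\right]$$ be the Gegenbauer polynomial of degree $n$, where $(z)_n=z(z+1)\cdots(z+n-1)$ is the Pochhammer symbol, and let $$h_n^\lambda=\frac{\pi\,2^{1-2\lambda}\,\Gamma(n+2\lambda)}{\Gamma(\lambda)^2\,\Gamma(n+1)\,(n+\lambda)}.$$ **Theorem.** Let $\rho>1$, and let $f$ be analytic in the open region bounded by $\mathcal{E}_\rho$ and continuous on the closure of this region. Let $\lambda>-1/2$, $\lambda\ne0$, let $M=\max_{z\in\mathcal{E}_\rho}|f(z)|$, and let $$a_k^\lambda=\frac{1}{h_k^\lambda}\int_{-1}^{1}(1-x^2)^{\lambda-1/2}\,C_k^\lambda(x)\,f(x)\,\mathrm{d}x\qquad(k\ge0)$$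 be the Gegenbauer coefficients of $f$. Then $$|a_0^\lambda|\le D_\lambda(\rho)\begin{cases}\dfrac{1}{|\Gamma(\lambda)|}, & -1/2<\lambda<0,\\[6pt] \lambda, & 0<\lambda\le1,\\[6pt] \dfrac{1}{\Gamma(\lambda)}, & \lambda>1,\end{cases}\qquad\text{and}\qquad |a_k^\lambda|\le D_\lambda(\rho)\,\frac{k^{1-\lambda}}{\rho^k}\quad\text{for all } k\ge1,$$ where $$D_\lambda(\rho)=\frac{M\,L(\mathcal{E}_\rho)}{\pi\rho}\begin{cases}\dfrac{|\Gamma(\lambda)|\,\Gamma(1+\lambda)\,\Gamma(1-2\lambda)}{\Gamma(1-\lambda)}\left(1-\dfrac1{\rho^2}\right)^{2\lambda-1}, & -1/2<\lambda<0,\\[8pt] \dfrac1\lambda\left(1-\dfrac1{\rho^2}\right)^{\lambda-1}, & 0<\lambda\le1,\\[8pt] \Gamma(\lambda)\left(1+\dfrac1{\rho^2}\right)^{\lambda-1}, & \lambda>1.\end{cases}$$ -/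

import Mathlib

/-- The Gegenbauer (ultraspherical) polynomial `C_n^lam`, as a terminating Gauss hypergeometric
series: `C_n^lam(x) = (2 lam)_n / n! * ₂F₁(-n, n + 2 lam; lam + 1/2; (1 - x)/2)`. -/
noncomputable def gegenbauerC (lam : ℝ) (n : ℕ) (x : ℝ) : ℝ :=
  (ascPochhammer ℝ n).eval (2 * lam) / (n.factorial : ℝ) *
    ordinaryHypergeometric (-(n : ℝ)) ((n : ℝ) + 2 * lam) (lam + 1 / 2) ((1 - x) / 2)

/-- The Gegenbauer weight `(1 - x^2)^(lam - 1/2)`. -/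
noncomputable def gegenbauerWeight (lam x : ℝ) : ℝ :=
  (1 - x ^ 2) ^ (lam - 1 / 2)

/-- The normalization constant `h_n^lam` (the squared weighted `L²` norm of `C_n^lam`). -/
noncomputable def gegenbauerH (lam : ℝ) (n : ℕ) : ℝ :=
  Real.pi * 2 ^ (1 - 2 * lam) * Real.Gamma ((n : ℝ) + 2 * lam) /
    (Real.Gamma lam ^ 2 * Real.Gamma ((n : ℝ) + 1) * ((n : ℝ) + lam))

/-- The Gegenbauer coefficient
`a_k^lam = (1 / h_k^lam) * ∫_{-1}^{1} (1 - x^2)^(lam - 1/2) C_k^lam(x) f(x) dx`. -/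
noncomputable def gegenbauerCoeff (f : ℂ → ℂ) (lam : ℝ) (k : ℕ) : ℂ :=
  (1 / (gegenbauerH lam k : ℂ)) *
    ∫ x in (-1 : ℝ)..1, ((gegenbauerWeight lam x * gegenbauerC lam k x : ℝ) : ℂ) * f (x : ℂ)

/-- The Bernstein ellipse `{(u + u⁻¹) / 2 : |u| = ρ}`. -/
def bernsteinEllipse (ρ : ℝ) : Set ℂ :=
  {z | ∃ u : ℂ, ‖u‖ = ρ ∧ z = (u + u⁻¹) / 2}

/-- The open region bounded by the Bernstein ellipse, which has foci `±1` and major semi-axis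
`(ρ + ρ⁻¹) / 2`: the points whose distances to the foci sum to less than `ρ + ρ⁻¹`. -/
def bernsteinInterior (ρ : ℝ) : Set ℂ :=
  {z | ‖z - 1‖ + ‖z + 1‖ < ρ + ρ⁻¹}

/-- The Bernstein ellipse is the ellipse with foci `±1` and major semi-axis `(ρ + ρ⁻¹) / 2`, so it
is the boundary curve of `bernsteinInterior ρ`. -/
theorem bernsteinEllipse_eq (ρ : ℝ) (hρ : 1 < ρ) :
    bernsteinEllipse ρ = {z | ‖z - 1‖ + ‖z + 1‖ = ρ + ρ⁻¹} := by
  have key : ∀ u : ℂ, u ≠ 0 → ‖(u + u⁻¹) / 2 - 1‖ + ‖(u + u⁻¹) / 2 + 1‖ = ‖u‖ + ‖u‖⁻¹ := by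
    intro u hu
    have h1 : (u + u⁻¹) / 2 - 1 = (u - 1) ^ 2 / (2 * u) := by field_simp; ring
    have h2 : (u + u⁻¹) / 2 + 1 = (u + 1) ^ 2 / (2 * u) := by field_simp; ring
    have hn : ‖u‖ ≠ 0 := norm_ne_zero_iff.2 hu
    have hp := parallelogram_law_with_norm ℝ u 1
    rw [h1, h2]
    simp only [norm_div, norm_pow, norm_mul, Complex.norm_ofNat]
    simp only [norm_one] at hp
    field_simp
    nlinarith
  ext z
  simp only [bernsteinEllipse, Set.mem_ofPred_eq]
  constructor
  · rintro ⟨u, hu, rfl⟩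
    have : u ≠ 0 := by rintro rfl; simp at hu; linarith
    rw [key u this, hu]
  · intro hz
    obtain ⟨s, hs⟩ := IsAlgClosed.exists_pow_nat_eq (z ^ 2 - 1) (n := 2) (by norm_num)
    have hm : (z + s) * (z - s) = 1 := by linear_combination -hs
    have h0 : z + s ≠ 0 := left_ne_zero_of_mul_eq_one hm
    have hi : (z + s)⁻¹ = z - s := inv_eq_of_mul_eq_one_right hm
    have hzz : z = ((z + s) + (z + s)⁻¹) / 2 := by rw [hi]; ring
    have hk := key _ h0
    rw [← hzz, hz] at hk
    set r := ‖z + s‖ with hr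
    have hr0 : 0 < r := norm_pos_iff.2 h0
    have : (ρ - r) * (ρ * r - 1) = 0 := by
      field_simp at hk
      linarith
    rcases mul_eq_zero.1 this with h | h
    · exact ⟨z + s, by linarith, hzz⟩
    · refine ⟨(z + s)⁻¹, ?_, ?_⟩
      · rw [norm_inv, ← hr]; field_simp; linarith
      · rw [inv_inv, add_comm]; exact hzz

/-- The parametrization `θ ↦ (ρ e^{iθ} + ρ⁻¹ e^{-iθ}) / 2` of the Bernstein ellipse. -/
noncomputable def bernsteinParam (ρ θ : ℝ) : ℂ :=
  (circleMap 0 ρ θ + (circleMap 0 ρ θ)⁻¹) / 2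

/-- The length of the circumference of the Bernstein ellipse (for `ρ > 1`), as arc length. -/
noncomputable def bernsteinLength (ρ : ℝ) : ℝ :=
  ∫ θ in (0 : ℝ)..(2 * Real.pi), ‖deriv (bernsteinParam ρ) θ‖

/-- `M = max_{z ∈ E_ρ} |f(z)|`; a maximum, since `E_ρ` is compact, if `f` is continuous on it. -/
noncomputable def bernsteinMax (f : ℂ → ℂ) (ρ : ℝ) : ℝ :=
  sSup ((fun z => ‖f z‖) '' bernsteinEllipse ρ)

/-- The constant `D_lam(ρ)`, given separately on `(-1/2, 0)`, `(0, 1]` and `(1, ∞)`. -/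
noncomputable def gegenbauerD (f : ℂ → ℂ) (lam ρ : ℝ) : ℝ :=
  bernsteinMax f ρ * bernsteinLength ρ / (Real.pi * ρ) *
    if lam < 0 then
      |Real.Gamma lam| * Real.Gamma (1 + lam) * Real.Gamma (1 - 2 * lam) / Real.Gamma (1 - lam) *
        (1 - 1 / ρ ^ 2) ^ (2 * lam - 1)
    else if lam ≤ 1 then
      1 / lam * (1 - 1 / ρ ^ 2) ^ (lam - 1)
    else
      Real.Gamma lam * (1 + 1 / ρ ^ 2) ^ (lam - 1)

/-- The factor multiplying `D_lam(ρ)` in the bound for the coefficient of index `0`. -/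
noncomputable def gegenbauerZeroFactor (lam : ℝ) : ℝ :=
  if lam < 0 then 1 / |Real.Gamma lam|
  else if lam ≤ 1 then lam
  else 1 / Real.Gamma lam

/-!
Since `gegenbauerOp lam` is self-adjoint for the Gegenbauer weight and maps `2 T_m` to a combination
of `U_m` and `U_{m-2}`, the integrals of `C_k^lam U_m` against the weight satisfy a two-term
recurrence in `m`. They vanish unless `m = k + 2j`, and are then proportional to the coefficients of
`₂F₁(k + 1, 1 - lam; k + lam + 1; ·)`.

The Laurent expansion of `f((u + u⁻¹) / 2)` in `1 < |u| < ρ` gives `f = ∑ b_m U_m` on `[-1, 1]`,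
where `b_m = (1 / πi) ∮ f(z) u^(-m-1) dz` over the Bernstein ellipse. Integrating termwise,
`a_k = Γ(lam) k! / Γ(k + lam) *
  (1 / πi) ∮ f(z) u^(-k-1) ₂F₁(k + 1, 1 - lam; k + lam + 1; u⁻²) dz`.

For `lam > 0`, Euler's integral writes `₂F₁` as an average of `(1 - t u⁻²) ^ (lam - 1)`.
For `lam < 0` its coefficients are at most a multiple of those of `(1 - x) ^ (2 lam - 1)`, by
log-convexity of `Γ`. The same convexity, or Bernoulli's inequality if `0 < lam ≤ 1`, bounds
`Γ(lam) k! / Γ(k + lam)` by a multiple of `k ^ (1 - lam)`.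
-/

open Polynomial MeasureTheory

section HypergeometricCoefficients

variable {𝕂 : Type*} [Field 𝕂]

lemma ascPochhammer_eval_succ_left (n : ℕ) (z : 𝕂) :
    (ascPochhammer 𝕂 (n + 1)).eval z = z * (ascPochhammer 𝕂 n).eval (z + 1) := by
  simp [ascPochhammer_succ_left, eval_comp]

lemma ordinaryHypergeometricCoefficient_neg_natCast_eq_zero {n k : ℕ} (b c : 𝕂) (h : n < k) :
    ordinaryHypergeometricCoefficient (-n : 𝕂) b c k = 0 := by
  have : (ascPochhammer 𝕂 k).eval (-n : 𝕂) = 0 :=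
    (ascPochhammer_eval_eq_zero_iff k _).2 ⟨n, h, (neg_neg _).symm⟩
  simp [this]

/-- The polynomial given by the terminating Gauss series `₂F₁(-n, b; c; X)`. -/
noncomputable def hypergeometricPoly (n : ℕ) (b c : 𝕂) : 𝕂[X] :=
  ∑ k ∈ Finset.range (n + 1), C (ordinaryHypergeometricCoefficient (-n : 𝕂) b c k) * X ^ k

lemma coeff_hypergeometricPoly (n : ℕ) (b c : 𝕂) (k : ℕ) :
    (hypergeometricPoly n b c).coeff k = ordinaryHypergeometricCoefficient (-n : 𝕂) b c k := by
  simp only [hypergeometricPoly, finsetSum_coeff, coeff_C_mul_X_pow, Finset.sum_ite_eq,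
    Finset.mem_range, Nat.lt_succ_iff, ite_eq_left_iff, not_le]
  exact fun h => (ordinaryHypergeometricCoefficient_neg_natCast_eq_zero b c h).symm

lemma eval_hypergeometricPoly [TopologicalSpace 𝕂] [IsTopologicalRing 𝕂] (n : ℕ) (b c x : 𝕂) :
    (hypergeometricPoly n b c).eval x = ordinaryHypergeometric (-n : 𝕂) b c x := by
  rw [ordinaryHypergeometric_eq_tsum]
  refine .trans ?_ (tsum_eq_sum (s := Finset.range (n + 1)) fun k hk => ?_).symm
  · simp [hypergeometricPoly, eval_finsetSum]
  · rw [← ordinaryHypergeometricCoefficient,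
      ordinaryHypergeometricCoefficient_neg_natCast_eq_zero b c (by simpa using hk), zero_smul]

variable [CharZero 𝕂]

lemma ordinaryHypergeometricCoefficient_succ (a b : 𝕂) {c : 𝕂} {n : ℕ} (hc : c + n ≠ 0) :
    (n + 1) * (c + n) * ordinaryHypergeometricCoefficient a b c (n + 1) =
      (a + n) * (b + n) * ordinaryHypergeometricCoefficient a b c n := by
  have hn : (n + 1 : 𝕂) ≠ 0 := by exact_mod_cast n.succ_ne_zero
  simp only [ordinaryHypergeometricCoefficient, ascPochhammer_succ_eval, Nat.factorial_succ,
    Nat.cast_mul, Nat.cast_succ, mul_inv]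
  field_simp

lemma succ_mul_ordinaryHypergeometricCoefficient_succ (a b c : 𝕂) (n : ℕ) :
    (n + 1) * ordinaryHypergeometricCoefficient a b c (n + 1) =
      a * b / c * ordinaryHypergeometricCoefficient (a + 1) (b + 1) (c + 1) n := by
  have hn : (n + 1 : 𝕂) ≠ 0 := by exact_mod_cast n.succ_ne_zero
  simp only [ordinaryHypergeometricCoefficient, ascPochhammer_eval_succ_left, Nat.factorial_succ,
    Nat.cast_mul, Nat.cast_succ, mul_inv]
  field_simp

lemma derivative_hypergeometricPoly (n : ℕ) (b c : 𝕂) :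
    derivative (hypergeometricPoly (n + 1) b c) =
      C (-(n + 1) * b / c) * hypergeometricPoly n (b + 1) (c + 1) := by
  ext k
  rw [coeff_derivative, coeff_C_mul, coeff_hypergeometricPoly, coeff_hypergeometricPoly, mul_comm,
    succ_mul_ordinaryHypergeometricCoefficient_succ, Nat.cast_succ, neg_add, neg_add_cancel_right]

lemma hypergeometricPoly_ode (n : ℕ) (b : 𝕂) {c : 𝕂} (hc : ∀ k : ℕ, c + k ≠ 0) :
    X * (1 - X) * derivative (derivative (hypergeometricPoly n b c)) +
        (C c - C (-n + b + 1) * X) * derivative (hypergeometricPoly n b c) =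
      C (-n * b) * hypergeometricPoly n b c := by
  have expand (p : 𝕂[X]) : X * (1 - X) * derivative (derivative p) +
      (C c - C (-n + b + 1) * X) * derivative p =
      X * derivative (derivative p) - X * (X * derivative (derivative p)) +
        C c * derivative p - C (-n + b + 1) * (X * derivative p) := by ring
  rw [expand]
  ext k
  have h := ordinaryHypergeometricCoefficient_succ (-n : 𝕂) b (hc k)
  rcases k with _ | _ | k <;>
  · simp only [coeff_add, coeff_sub, coeff_C_mul, coeff_X_mul, coeff_derivative,
      coeff_hypergeometricPoly, coeff_X_mul_zero]
    push_cast at h ⊢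
    linear_combination h

end HypergeometricCoefficients

lemma Gamma_add_natCast {s : ℝ} (hs : ∀ k : ℕ, s ≠ -k) (n : ℕ) :
    Real.Gamma (s + n) = (ascPochhammer ℝ n).eval s * Real.Gamma s := by
  induction n with
  | zero => simp
  | succ n ih =>
    have hn : s + n ≠ 0 := fun h => hs n (eq_neg_of_add_eq_zero_left h)
    rw [ascPochhammer_succ_eval, Nat.cast_succ, ← add_assoc, Real.Gamma_add_one hn, ih]
    ring

section GegenbauerPolynomials

/-- The Gegenbauer polynomial `₂F₁(-n, n + 2 lam; lam + 1/2; (1 - X)/2)`, normalized to take the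
value `1` at `1`. -/
noncomputable def gegenbauerPoly (lam : ℝ) (n : ℕ) : ℝ[X] :=
  (hypergeometricPoly n (n + 2 * lam) (lam + 1 / 2)).comp (C (1 / 2) * (1 - X))

lemma gegenbauerC_eq_eval_gegenbauerPoly (lam : ℝ) (n : ℕ) (x : ℝ) :
    gegenbauerC lam n x =
      (ascPochhammer ℝ n).eval (2 * lam) / n.factorial * (gegenbauerPoly lam n).eval x := by
  simp only [gegenbauerC, gegenbauerPoly, eval_comp, eval_hypergeometricPoly, eval_mul, eval_C,
    eval_sub, eval_one, eval_X, one_div_mul_eq_div]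

lemma gegenbauerPoly_zero (lam : ℝ) : gegenbauerPoly lam 0 = 1 := by
  simp [gegenbauerPoly, hypergeometricPoly]

lemma derivative_gegenbauerPoly (lam : ℝ) (n : ℕ) :
    derivative (gegenbauerPoly lam (n + 1)) =
      C ((n + 1) * (n + 1 + 2 * lam) / (2 * lam + 1)) * gegenbauerPoly (lam + 1) n := by
  have hb : ((n + 1 : ℕ) : ℝ) + 2 * lam + 1 = n + 2 * (lam + 1) := by push_cast; ring
  have hinner : derivative (C (1 / 2) * (1 - X) : ℝ[X]) = C (-(1 / 2)) := by simp
  simp only [gegenbauerPoly, derivative_comp, derivative_hypergeometricPoly, mul_comp, C_comp, hb,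
    hinner, add_right_comm lam (1 / 2) 1]
  rw [← mul_assoc, ← C_mul]
  congr 2
  rw [show lam + 1 / 2 = (2 * lam + 1) / 2 by ring]
  push_cast
  field_simp

/-- The differential operator `q ↦ (1 - X²) D²q - (2 lam + 1) X Dq`, whose polynomial
eigenfunctions are the Gegenbauer polynomials of parameter `lam`. -/
noncomputable def gegenbauerOp (lam : ℝ) (q : ℝ[X]) : ℝ[X] :=
  (1 - X ^ 2) * derivative (derivative q) - C (2 * lam + 1) * X * derivative q

lemma gegenbauerOp_gegenbauerPoly {lam : ℝ} (hlam : -(1 / 2) < lam) (n : ℕ) :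
    gegenbauerOp lam (gegenbauerPoly lam n) = C (-(n * (n + 2 * lam))) * gegenbauerPoly lam n := by
  have hc (k : ℕ) : lam + 1 / 2 + k ≠ 0 := by linarith
  have ode := congrArg (·.comp (C (1 / 2) * (1 - X))) (hypergeometricPoly_ode n (n + 2 * lam) hc)
  have hinner : derivative (C (1 / 2) * (1 - X) : ℝ[X]) = C (-(1 / 2)) := by simp
  have half : (2 : ℝ[X]) * C (1 / 2) = 1 := by rw [← C_ofNat, ← C_mul]; norm_num
  simp only [add_comp, mul_comp, sub_comp, X_comp, one_comp, C_comp, neg_mul] at ode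
  simp only [gegenbauerOp, gegenbauerPoly, derivative_comp, derivative_mul, derivative_C, hinner]
  rw [← ode, show -(n : ℝ) + (n + 2 * lam) + 1 = 2 * lam + 1 by ring,
    show lam + 1 / 2 = (2 * lam + 1) * (1 / 2) by ring, C_mul, C_neg]
  generalize (derivative (derivative (hypergeometricPoly (𝕂 := ℝ) n _ _))).comp _ = secondDeriv
  linear_combination C (1 / 2) * (1 - X) * secondDeriv * half

end GegenbauerPolynomials

lemma beta_eq_integral {a b : ℝ} (ha : 0 < a) (hb : 0 < b) :
    ProbabilityTheory.beta a b = ∫ t in (0 : ℝ)..1, t ^ (a - 1) * (1 - t) ^ (b - 1) := by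
  have hcast : Complex.betaIntegral a b =
      ((∫ t in (0 : ℝ)..1, t ^ (a - 1) * (1 - t) ^ (b - 1) : ℝ) : ℂ) := by
    rw [Complex.betaIntegral, ← intervalIntegral.integral_ofReal]
    refine intervalIntegral.integral_congr_uIoo fun t ht => ?_
    rw [Set.uIoo_of_le zero_le_one] at ht
    push_cast [Complex.ofReal_cpow ht.1.le, Complex.ofReal_cpow (sub_nonneg.2 ht.2.le)]
    rfl
  rw [ProbabilityTheory.beta_eq_betaIntegralReal a b ha hb, hcast, Complex.ofReal_re]

section GegenbauerWeight

lemma gegenbauerWeight_neg (lam x : ℝ) : gegenbauerWeight lam (-x) = gegenbauerWeight lam x := by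
  simp [gegenbauerWeight]

lemma gegenbauerWeight_add_one (lam : ℝ) {x : ℝ} (hx : x ∈ Set.Ioo (-1 : ℝ) 1) :
    gegenbauerWeight (lam + 1) x = gegenbauerWeight lam x * (1 - x ^ 2) := by
  have hpos : 0 < 1 - x ^ 2 := by nlinarith [hx.1, hx.2]
  rw [gegenbauerWeight, gegenbauerWeight, show lam + 1 - 1 / 2 = lam - 1 / 2 + 1 by ring,
    Real.rpow_add_one hpos.ne']

/-- The integral of a polynomial over `[-1, 1]` against the Gegenbauer weight. -/
noncomputable def weightedInt (lam : ℝ) (q : ℝ[X]) : ℝ :=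
  ∫ x in (-1 : ℝ)..1, gegenbauerWeight lam x * q.eval x

lemma weightedInt_C_mul (lam c : ℝ) (p : ℝ[X]) :
    weightedInt lam (C c * p) = c * weightedInt lam p := by
  simp only [weightedInt, eval_mul, eval_C, ← intervalIntegral.integral_const_mul,
    mul_left_comm c]

lemma weightedInt_add_one (lam : ℝ) (q : ℝ[X]) :
    weightedInt (lam + 1) q = weightedInt lam ((1 - X ^ 2) * q) := by
  refine intervalIntegral.integral_congr_uIoo fun x hx => ?_
  rw [Set.uIoo_of_le (by norm_num)] at hx
  simp only [gegenbauerWeight_add_one lam hx, eval_mul, eval_sub, eval_one, eval_pow, eval_X,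
    mul_assoc]

variable {lam : ℝ} (hlam : -(1 / 2) < lam)
include hlam

lemma intervalIntegrable_gegenbauerWeight :
    IntervalIntegrable (gegenbauerWeight lam) volume (-1) 1 := by
  have right_half : IntervalIntegrable (gegenbauerWeight lam) volume 0 1 := by
    have hsing : IntervalIntegrable (fun x : ℝ => (1 - x) ^ (lam - 1 / 2)) volume 0 1 := by
      have := (intervalIntegral.intervalIntegrable_rpow' (a := 0) (b := 1)
        (r := lam - 1 / 2) (by linarith)).comp_sub_left 1
      simpa using this.symm
    have hcont : ContinuousOn (fun x : ℝ => (1 + x) ^ (lam - 1 / 2)) (Set.uIcc 0 1) := by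
      refine ContinuousOn.rpow_const (by fun_prop) fun x hx => .inl ?_
      rw [Set.uIcc_of_le zero_le_one] at hx
      linarith [hx.1]
    refine (hsing.mul_continuousOn hcont).congr_uIoo fun x hx => ?_
    rw [Set.uIoo_of_le zero_le_one] at hx
    simp only [gegenbauerWeight]
    rw [← Real.mul_rpow (by linarith [hx.2]) (by linarith [hx.1])]
    ring_nf
  have left_half := right_half.comp_sub_left 0
  simp only [sub_zero, zero_sub, gegenbauerWeight_neg] at left_half
  exact left_half.symm.trans right_half

lemma intervalIntegrable_gegenbauerWeight_mul_eval (q : ℝ[X]) :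
    IntervalIntegrable (fun x => gegenbauerWeight lam x * q.eval x) volume (-1) 1 :=
  (intervalIntegrable_gegenbauerWeight hlam).mul_continuousOn q.continuous.continuousOn

lemma weightedInt_add (p q : ℝ[X]) :
    weightedInt lam (p + q) = weightedInt lam p + weightedInt lam q := by
  simp only [weightedInt, eval_add, mul_add]
  exact intervalIntegral.integral_add (intervalIntegrable_gegenbauerWeight_mul_eval hlam p)
    (intervalIntegrable_gegenbauerWeight_mul_eval hlam q)

lemma weightedInt_sub (p q : ℝ[X]) :
    weightedInt lam (p - q) = weightedInt lam p - weightedInt lam q := by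
  simp only [weightedInt, eval_sub, mul_sub]
  exact intervalIntegral.integral_sub (intervalIntegrable_gegenbauerWeight_mul_eval hlam p)
    (intervalIntegrable_gegenbauerWeight_mul_eval hlam q)

-- The integrand is the derivative of `(1 - x²)^(lam + 1/2) q(x)`, which vanishes at `±1`.
lemma weightedInt_one_sub_X_sq_mul_derivative_sub (q : ℝ[X]) :
    weightedInt lam ((1 - X ^ 2) * derivative q - C (2 * lam + 1) * X * q) = 0 := by
  have hcont : ContinuousOn (fun x : ℝ => (1 - x ^ 2) ^ (lam + 1 / 2) * q.eval x)
      (Set.Icc (-1) 1) :=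
    (ContinuousOn.rpow_const (by fun_prop) fun x _ => .inr (by linarith)).mul
      q.continuous.continuousOn
  have hderiv (x : ℝ) (hx : x ∈ Set.Ioo (-1 : ℝ) 1) :
      HasDerivAt (fun x : ℝ => (1 - x ^ 2) ^ (lam + 1 / 2) * q.eval x)
        (gegenbauerWeight lam x *
          ((1 - X ^ 2) * derivative q - C (2 * lam + 1) * X * q).eval x) x := by
    have hpos : 0 < 1 - x ^ 2 := by nlinarith [hx.1, hx.2]
    have hbase : HasDerivAt (fun x : ℝ => 1 - x ^ 2) (-(2 * x)) x := by
      simpa using (hasDerivAt_pow 2 x).const_sub 1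
    refine ((hbase.rpow_const (p := lam + 1 / 2) (.inl hpos.ne')).mul
      (q.hasDerivAt x)).congr_deriv ?_
    rw [show lam + 1 / 2 - 1 = lam - 1 / 2 by ring,
      show lam + 1 / 2 = (lam - 1 / 2) + 1 by ring, Real.rpow_add_one hpos.ne', gegenbauerWeight]
    simp only [eval_sub, eval_mul, eval_one, eval_pow, eval_X, eval_C]
    ring
  have hexp : lam + 1 / 2 ≠ 0 := by linarith
  rw [weightedInt, intervalIntegral.integral_eq_sub_of_hasDerivAt_of_le (by norm_num) hcont hderiv
    (intervalIntegrable_gegenbauerWeight_mul_eval hlam _)]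
  norm_num [Real.zero_rpow hexp]

lemma weightedInt_mul_gegenbauerOp (p q : ℝ[X]) :
    weightedInt lam (p * gegenbauerOp lam q) =
      -weightedInt (lam + 1) (derivative p * derivative q) := by
  rw [weightedInt_add_one, ← sub_eq_zero, sub_neg_eq_add, ← weightedInt_add hlam,
    ← weightedInt_one_sub_X_sq_mul_derivative_sub hlam (p * derivative q)]
  congr 1
  simp only [gegenbauerOp, derivative_mul]
  ring

lemma weightedInt_gegenbauerPoly_mul_gegenbauerOp (n : ℕ) (p : ℝ[X]) :
    weightedInt lam (gegenbauerPoly lam n * gegenbauerOp lam p) =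
      -(n * (n + 2 * lam)) * weightedInt lam (gegenbauerPoly lam n * p) := by
  rw [weightedInt_mul_gegenbauerOp hlam, mul_comm, ← weightedInt_mul_gegenbauerOp hlam,
    gegenbauerOp_gegenbauerPoly hlam, ← weightedInt_C_mul, mul_left_comm, mul_comm p]

lemma weightedInt_gegenbauerPoly_succ_mul (n : ℕ) (p : ℝ[X]) :
    weightedInt lam (gegenbauerPoly lam (n + 1) * p) =
      1 / (2 * lam + 1) * weightedInt (lam + 1) (gegenbauerPoly (lam + 1) n * derivative p) := by
  have h := weightedInt_mul_gegenbauerOp hlam p (gegenbauerPoly lam (n + 1))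
  rw [gegenbauerOp_gegenbauerPoly hlam, derivative_gegenbauerPoly, mul_left_comm,
    weightedInt_C_mul, mul_left_comm, weightedInt_C_mul, mul_comm p,
    mul_comm (derivative p)] at h
  have heigen : (n : ℝ) + 1 + 2 * lam ≠ 0 := by linarith
  have hweight : 2 * lam + 1 ≠ 0 := by linarith
  push_cast at h
  field_simp at h ⊢
  linarith

lemma weightedInt_gegenbauerPoly_mul (n : ℕ) (p : ℝ[X]) :
    weightedInt lam (gegenbauerPoly lam n * p) =
      1 / (2 ^ n * (ascPochhammer ℝ n).eval (lam + 1 / 2)) *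
        weightedInt (lam + n) (derivative^[n] p) := by
  induction n generalizing lam p with
  | zero => simp [gegenbauerPoly_zero]
  | succ n ih =>
    rw [weightedInt_gegenbauerPoly_succ_mul hlam, ih (by linarith), ascPochhammer_eval_succ_left,
      Function.iterate_succ_apply, add_right_comm lam 1 (1 / 2), ← mul_assoc, add_assoc lam 1,
      add_comm 1 (n : ℝ), ← Nat.cast_succ]
    congr 1
    rw [show lam + 1 / 2 = (2 * lam + 1) / 2 by ring]
    field_simp
    ring

lemma weightedInt_one_eq_beta :
    weightedInt lam 1 = 2 ^ (2 * lam) * ProbabilityTheory.beta (lam + 1 / 2) (lam + 1 / 2) := by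
  have hs : 0 < lam + 1 / 2 := by linarith
  calc weightedInt lam 1
      = 2 * ∫ t in (0 : ℝ)..1, gegenbauerWeight lam (2 * t - 1) := by
        rw [intervalIntegral.integral_comp_mul_sub (gegenbauerWeight lam) two_ne_zero]
        norm_num [weightedInt, ← mul_assoc]
    _ = 2 * ∫ t in (0 : ℝ)..1,
          4 ^ (lam - 1 / 2) * (t ^ (lam + 1 / 2 - 1) * (1 - t) ^ (lam + 1 / 2 - 1)) := by
        congr 1
        refine intervalIntegral.integral_congr_uIoo fun t ht => ?_
        rw [Set.uIoo_of_le zero_le_one] at ht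
        have h1t : 0 ≤ 1 - t := sub_nonneg.2 ht.2.le
        simp only [gegenbauerWeight]
        rw [show lam + 1 / 2 - 1 = lam - 1 / 2 by ring, ← Real.mul_rpow ht.1.le h1t,
          ← Real.mul_rpow (by norm_num) (mul_nonneg ht.1.le h1t)]
        ring_nf
    _ = 2 ^ (2 * lam) * ProbabilityTheory.beta (lam + 1 / 2) (lam + 1 / 2) := by
        rw [intervalIntegral.integral_const_mul, ← beta_eq_integral hs hs, ← mul_assoc,
          show (4 : ℝ) = 2 ^ (2 : ℝ) by norm_num, ← Real.rpow_mul two_pos.le,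
          show 2 * lam = 1 + 2 * (lam - 1 / 2) by ring, Real.rpow_add two_pos, Real.rpow_one]

lemma weightedInt_one :
    weightedInt lam 1 = √Real.pi * Real.Gamma (lam + 1 / 2) / Real.Gamma (lam + 1) := by
  have hone : 0 < Real.Gamma (lam + 1) := Real.Gamma_pos_of_pos (by linarith)
  have hdouble : 0 < Real.Gamma (2 * (lam + 1 / 2)) := Real.Gamma_pos_of_pos (by linarith)
  have duplication : Real.Gamma (lam + 1 / 2) * Real.Gamma (lam + 1) * 2 ^ (2 * lam) =
      Real.Gamma (2 * (lam + 1 / 2)) * √Real.pi := by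
    have h := Real.Gamma_mul_Gamma_add_half (lam + 1 / 2)
    rw [show lam + 1 / 2 + 1 / 2 = lam + 1 by ring,
      show 1 - 2 * (lam + 1 / 2) = -(2 * lam) by ring, Real.rpow_neg two_pos.le] at h
    rw [h]
    field_simp
  rw [weightedInt_one_eq_beta hlam, ProbabilityTheory.beta, ← two_mul, mul_div_assoc',
    div_eq_div_iff hdouble.ne' hone.ne']
  linear_combination Real.Gamma (lam + 1 / 2) * duplication

end GegenbauerWeight

section ChebyshevMoments

lemma gegenbauerOp_two_mul_chebyshevT (lam : ℝ) (m : ℤ) :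
    gegenbauerOp lam (2 * Chebyshev.T ℝ (m + 2)) =
      C (-((m + 2) * (m + 2 + 2 * lam))) * Chebyshev.U ℝ (m + 2) +
        C ((m + 2) * (m + 2 - 2 * lam)) * Chebyshev.U ℝ m := by
  have chebyshev_ode :=
    Chebyshev.one_sub_X_sq_mul_derivative_derivative_T_eq_poly_in_T (R := ℝ) (m + 2)
  have hderiv := Chebyshev.T_derivative_eq_U (R := ℝ) (m + 2)
  rw [show m + 2 - 1 = m + 1 by ring] at hderiv
  simp only [Function.iterate_succ, Function.iterate_zero, Function.comp_apply, id, hderiv,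
    derivative_mul] at chebyshev_ode
  simp only [gegenbauerOp, derivative_mul, derivative_ofNat, zero_mul, zero_add, hderiv]
  push_cast at chebyshev_ode ⊢
  simp only [C_add, C_mul, C_neg, C_sub, C_ofNat, C_1, map_intCast]
  linear_combination 2 * chebyshev_ode - (m + 2 : ℝ[X]) ^ 2 * Chebyshev.two_mul_T_eq_U_sub_U ℝ m +
    2 * C lam * (m + 2) * Chebyshev.U_add_two ℝ m

lemma iterate_derivative_chebyshevU_self (n : ℕ) :
    derivative^[n] (Chebyshev.U ℝ n) = C ((2 : ℝ) ^ n * n.factorial) := by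
  have hdeg : (derivative^[n] (Chebyshev.U ℝ n)).natDegree = 0 := by
    simpa [Chebyshev.natDegree_U_natCast] using natDegree_iterate_derivative (Chebyshev.U ℝ n) n
  have hlead : (Chebyshev.U ℝ n).coeff n = 2 ^ n := by
    simpa [leadingCoeff, Chebyshev.natDegree_U_natCast] using Chebyshev.leadingCoeff_U_natCast ℝ n
  rw [eq_C_of_natDegree_eq_zero hdeg, coeff_iterate_derivative]
  simp [hlead, Nat.descFactorial_self, mul_comm]

/-- The integral of the Chebyshev polynomial `U_m` against the normalized Gegenbauer polynomial of
degree `n` and the Gegenbauer weight. -/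
noncomputable def chebyshevMoment (lam : ℝ) (n : ℕ) (m : ℤ) : ℝ :=
  weightedInt lam (gegenbauerPoly lam n * Chebyshev.U ℝ m)

variable {lam : ℝ} (hlam : -(1 / 2) < lam)
include hlam

lemma chebyshevMoment_recurrence (n : ℕ) (m : ℤ) :
    ((m : ℝ) + 2 - n) * (m + 2 + n + 2 * lam) * chebyshevMoment lam n (m + 2) =
      (m + 2 + n) * (m + 2 - n - 2 * lam) * chebyshevMoment lam n m := by
  have h := weightedInt_gegenbauerPoly_mul_gegenbauerOp hlam n (2 * Chebyshev.T ℝ (m + 2))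
  rw [gegenbauerOp_two_mul_chebyshevT, Chebyshev.two_mul_T_eq_U_sub_U, mul_add,
    mul_sub (gegenbauerPoly lam n), weightedInt_add hlam, weightedInt_sub hlam, mul_left_comm,
    weightedInt_C_mul, mul_left_comm, weightedInt_C_mul] at h
  simp only [chebyshevMoment]
  linear_combination -h

lemma chebyshevMoment_eq_zero_of_lt {m n : ℕ} (h : m < n) : chebyshevMoment lam n m = 0 := by
  have hU : derivative^[n] (Chebyshev.U ℝ m) = 0 :=
    iterate_derivative_eq_zero (by rwa [Chebyshev.natDegree_U_natCast])
  rw [chebyshevMoment, weightedInt_gegenbauerPoly_mul hlam n, hU]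
  simp [weightedInt]

lemma chebyshevMoment_sub_one_add_two_mul (n j : ℕ) :
    chebyshevMoment lam n (n - 1 + 2 * j : ℤ) = 0 := by
  induction j with
  | zero =>
    rcases n with _ | n
    · simp [chebyshevMoment, weightedInt]
    · simpa using chebyshevMoment_eq_zero_of_lt hlam n.lt_succ_self
  | succ j ih =>
    have recurrence := chebyshevMoment_recurrence hlam n (n - 1 + 2 * j)
    rw [ih, mul_zero] at recurrence
    have hne : ((n - 1 + 2 * j : ℤ) + 2 - n : ℝ) * ((n - 1 + 2 * j : ℤ) + 2 + n + 2 * lam) ≠ 0 := by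
      push_cast
      exact (mul_pos (by linarith) (by linarith)).ne'
    rw [Nat.cast_succ, mul_add, mul_one, ← add_assoc]
    exact (mul_eq_zero.1 recurrence).resolve_left hne

lemma chebyshevMoment_eq_zero {n m : ℕ} (h : ∀ j, m ≠ n + 2 * j) :
    chebyshevMoment lam n m = 0 := by
  rcases lt_or_ge m n with hmn | hmn
  · exact chebyshevMoment_eq_zero_of_lt hlam hmn
  · obtain ⟨i, rfl⟩ := Nat.exists_eq_add_of_le hmn
    obtain ⟨j, rfl | rfl⟩ := i.even_or_odd'
    · exact absurd rfl (h j)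
    · have := chebyshevMoment_sub_one_add_two_mul hlam n (j + 1)
      rwa [show (n - 1 + 2 * (j + 1 : ℕ) : ℤ) = (n + (2 * j + 1) : ℕ) by push_cast; ring] at this

lemma chebyshevMoment_add_two_mul (n j : ℕ) :
    chebyshevMoment lam n (n + 2 * j : ℕ) =
      ordinaryHypergeometricCoefficient (n + 1 : ℝ) (1 - lam) (n + lam + 1) j *
        chebyshevMoment lam n n := by
  induction j with
  | zero => simp [ordinaryHypergeometricCoefficient]
  | succ j ih =>
    have hc : (n : ℝ) + lam + 1 + j ≠ 0 := by linarith
    have hcoeff := ordinaryHypergeometricCoefficient_succ (n + 1 : ℝ) (1 - lam) hc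
    have hmoment := chebyshevMoment_recurrence hlam n (n + 2 * j : ℕ)
    rw [ih] at hmoment
    rw [show ((n + 2 * (j + 1) : ℕ) : ℤ) = (n + 2 * j : ℕ) + 2 by push_cast; ring]
    have hne : ((j : ℝ) + 1) * (n + lam + 1 + j) ≠ 0 := mul_ne_zero (by positivity) hc
    refine mul_left_cancel₀ hne ?_
    push_cast at hmoment ⊢
    linear_combination hmoment / 4 - chebyshevMoment lam n n * hcoeff

lemma chebyshevMoment_self (n : ℕ) :
    chebyshevMoment lam n n =
      n.factorial * √Real.pi * Real.Gamma (lam + 1 / 2) / Real.Gamma (n + lam + 1) := by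
  have hpos : 0 < lam + 1 / 2 := by linarith
  have hGamma : Real.Gamma (lam + n + 1 / 2) =
      (ascPochhammer ℝ n).eval (lam + 1 / 2) * Real.Gamma (lam + 1 / 2) := by
    rw [add_right_comm]
    exact Gamma_add_natCast (fun k => by linarith) n
  have hpoch := (ascPochhammer_pos n _ hpos).ne'
  rw [chebyshevMoment, weightedInt_gegenbauerPoly_mul hlam n, iterate_derivative_chebyshevU_self,
    ← mul_one (C _), weightedInt_C_mul, weightedInt_one (by linarith), hGamma, add_comm (n : ℝ)]
  generalize (ascPochhammer ℝ n).eval (lam + 1 / 2) = poch at *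
  field_simp

end ChebyshevMoments

section NormalizationConstant

lemma ne_neg_natCast {x : ℝ} (hx : -1 < x) (hx0 : x ≠ 0) (k : ℕ) : x ≠ -k := by
  rcases k.eq_zero_or_pos with rfl | hk
  · simpa using hx0
  · have : (1 : ℝ) ≤ k := by exact_mod_cast hk
    linarith

/-- The constant `Γ(lam) n! / Γ(n + lam)` in front of the contour integral for the `n`-th
Gegenbauer coefficient; it is the coefficient of `C_n^lam` in the Gegenbauer expansion of `U_n`. -/
noncomputable def gegenbauerConnection (lam : ℝ) (n : ℕ) : ℝ :=
  Real.Gamma lam * n.factorial / Real.Gamma (n + lam)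

lemma chebyshevMoment_self_div_gegenbauerH {lam : ℝ} (hlam : -(1 / 2) < lam) (hlam0 : lam ≠ 0)
    (n : ℕ) :
    (ascPochhammer ℝ n).eval (2 * lam) / n.factorial * chebyshevMoment lam n n /
      gegenbauerH lam n = gegenbauerConnection lam n := by
  have hlam_neg := ne_neg_natCast (by linarith) hlam0
  have htwo_neg := ne_neg_natCast (x := 2 * lam) (by linarith) (by simpa using hlam0)
  have hn : (n : ℝ) + lam ≠ 0 := fun h => hlam_neg n (by linarith)
  have hpoch : (ascPochhammer ℝ n).eval (2 * lam) ≠ 0 := by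
    rw [Ne, ascPochhammer_eval_eq_zero_iff]
    rintro ⟨k, -, hk⟩
    exact htwo_neg k (by linarith)
  have hΓ : Real.Gamma lam ≠ 0 := Real.Gamma_ne_zero hlam_neg
  have hΓ_two : Real.Gamma (2 * lam) ≠ 0 := Real.Gamma_ne_zero htwo_neg
  have duplication : Real.Gamma (lam + 1 / 2) =
      Real.Gamma (2 * lam) * 2 ^ (1 - 2 * lam) * √Real.pi / Real.Gamma lam := by
    rw [← Real.Gamma_mul_Gamma_add_half lam, mul_div_cancel_left₀ _ hΓ]
  have hpow : (2 : ℝ) ^ (1 - 2 * lam) ≠ 0 := (Real.rpow_pos_of_pos two_pos _).ne'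
  rw [chebyshevMoment_self hlam, gegenbauerH, gegenbauerConnection, Real.Gamma_nat_eq_factorial,
    Real.Gamma_add_one hn, add_comm (n : ℝ) (2 * lam), Gamma_add_natCast htwo_neg, duplication]
  generalize (2 : ℝ) ^ (1 - 2 * lam) = p at *
  field_simp
  rw [Real.sq_sqrt Real.pi_pos.le]

end NormalizationConstant

section HypergeometricSeries

lemma one_le_radius_ordinaryHypergeometricSeries {𝕂 : Type*} (𝔸 : Type*) [RCLike 𝕂]
    [NormedDivisionRing 𝔸] [NormedAlgebra 𝕂 𝔸] (a b c : 𝕂) :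
    1 ≤ (ordinaryHypergeometricSeries 𝔸 a b c).radius := by
  by_cases habc : ∀ k : ℕ, (k : 𝕂) ≠ -a ∧ (k : 𝕂) ≠ -b ∧ (k : 𝕂) ≠ -c
  · exact (ordinaryHypergeometricSeries_radius_eq_one 𝔸 a b c habc).ge
  · have hneg : ∃ k : ℕ, a = -(k : 𝕂) ∨ b = -(k : 𝕂) ∨ c = -(k : 𝕂) := by
      simpa only [not_forall, not_and_or, not_not, eq_neg_iff_add_eq_zero, add_comm] using habc
    obtain ⟨k, rfl | rfl | rfl⟩ := hneg
    · simp [ordinaryHypergeometric_radius_top_of_neg_nat₁]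
    · simp [ordinaryHypergeometric_radius_top_of_neg_nat₂]
    · simp [ordinaryHypergeometric_radius_top_of_neg_nat₃]

lemma summable_norm_ordinaryHypergeometricCoefficient_mul_pow {𝕂 : Type*} [RCLike 𝕂]
    (a b c : 𝕂) {r : ℝ} (hr₀ : 0 ≤ r) (hr₁ : r < 1) :
    Summable fun j => ‖ordinaryHypergeometricCoefficient a b c j‖ * r ^ j := by
  lift r to NNReal using hr₀
  simpa [ordinaryHypergeometricSeries, FormalMultilinearSeries.ofScalars_norm] using
    (ordinaryHypergeometricSeries 𝕂 a b c).summable_norm_mul_pow (r := r)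
      ((by exact_mod_cast hr₁ : (r : ENNReal) < 1).trans_le
        (one_le_radius_ordinaryHypergeometricSeries 𝕂 a b c))

lemma hasSum_ordinaryHypergeometric {𝕂 𝔸 : Type*} [RCLike 𝕂] [NormedDivisionRing 𝔸]
    [CompleteSpace 𝔸] [NormedAlgebra 𝕂 𝔸] (a b c : 𝕂) {x : 𝔸} (hx : ‖x‖ < 1) :
    HasSum (fun j => ordinaryHypergeometricCoefficient a b c j • x ^ j)
      (ordinaryHypergeometric a b c x) := by
  rw [ordinaryHypergeometric_eq_tsum]
  refine (Summable.of_norm ?_).hasSum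
  simpa only [norm_smul, norm_pow] using
    summable_norm_ordinaryHypergeometricCoefficient_mul_pow a b c (norm_nonneg x) hx

lemma choose_add_natCast_sub_one {R : Type*} [Field R] [CharZero R] [BinomialRing R] (a : R)
    (n : ℕ) : Ring.choose (a + n - 1) n = (ascPochhammer R n).eval a / n.factorial := by
  rw [eq_div_iff (by exact_mod_cast n.factorial_ne_zero), ← ascPochhammer_smeval_eq_eval,
    ← Ring.factorial_nsmul_multichoose_eq_ascPochhammer, Ring.choose, nsmul_eq_mul, mul_comm]
  ring_nf

lemma ofReal_ascPochhammer_eval (n : ℕ) (a : ℝ) :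
    (((ascPochhammer ℝ n).eval a : ℝ) : ℂ) = (ascPochhammer ℂ n).eval (a : ℂ) := by
  simpa [ascPochhammer_map] using!
    (eval_map_apply (f := Complex.ofRealHom) (p := ascPochhammer ℝ n) a).symm

lemma hasSum_one_sub_cpow_neg (a : ℝ) {z : ℂ} (hz : ‖z‖ < 1) :
    HasSum (fun j : ℕ => (((ascPochhammer ℝ j).eval a / j.factorial : ℝ) : ℂ) * z ^ j)
      ((1 - z) ^ (-a : ℂ)) := by
  have h := (Complex.one_div_one_sub_cpow_hasFPowerSeriesOnBall_zero (a : ℂ)).hasSum (y := z)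
    (by simpa [← ENNReal.ofReal_one, Metric.eball_ofReal] using hz)
  simpa [FormalMultilinearSeries.ofScalars_apply_eq, choose_add_natCast_sub_one, Complex.cpow_neg,
    mul_comm (z ^ _), ofReal_ascPochhammer_eval] using h

lemma hasSum_one_sub_rpow_neg (a : ℝ) {x : ℝ} (hx : |x| < 1) :
    HasSum (fun j : ℕ => (ascPochhammer ℝ j).eval a / j.factorial * x ^ j) ((1 - x) ^ (-a)) := by
  have h := (Real.one_div_one_sub_rpow_hasFPowerSeriesOnBall_zero a).hasSum (y := x)
    (by simpa [← ENNReal.ofReal_one, Metric.eball_ofReal] using hx)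
  simpa [FormalMultilinearSeries.ofScalars_apply_eq, choose_add_natCast_sub_one,
    mul_comm (x ^ _), Real.rpow_neg (sub_nonneg.2 (le_of_abs_le hx.le))] using h

end HypergeometricSeries

lemma hasSum_intervalIntegral_mul {w : ℝ → ℂ} {a b : ℝ} (hw : IntervalIntegrable w volume a b)
    {F : ℕ → ℝ → ℂ} {f : ℝ → ℂ} {B : ℕ → ℝ} (hF : ∀ j, Continuous (F j))
    (hFB : ∀ j, ∀ t ∈ Set.uIoc a b, ‖F j t‖ ≤ B j) (hB : Summable B)
    (hf : ∀ t ∈ Set.uIoc a b, HasSum (F · t) (f t)) :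
    HasSum (fun j => ∫ t in a..b, w t * F j t) (∫ t in a..b, w t * f t) := by
  refine intervalIntegral.hasSum_integral_of_dominated_convergence (fun j t => ‖w t‖ * B j)
    (fun j => hw.def'.aestronglyMeasurable.mul (hF j).aestronglyMeasurable)
    (fun j => .of_forall fun t ht => ?_) (.of_forall fun t _ => hB.mul_left _) ?_
    (.of_forall fun t ht => (hf t ht).mul_left _)
  · rw [norm_mul]
    exact mul_le_mul_of_nonneg_left (hFB j t ht) (norm_nonneg _)
  · simp only [tsum_mul_left]
    exact hw.norm.mul_const _

section EulerIntegral

variable {a c : ℝ} (ha : 0 < a) (hac : a < c)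
include ha hac

lemma intervalIntegrable_rpow_mul_one_sub_rpow :
    IntervalIntegrable (fun t : ℝ => t ^ (a - 1) * (1 - t) ^ (c - a - 1)) volume 0 1 := by
  refine intervalIntegral.intervalIntegrable_of_integral_ne_zero ?_
  rw [← beta_eq_integral ha (sub_pos.2 hac)]
  exact (ProbabilityTheory.beta_pos ha (sub_pos.2 hac)).ne'

lemma integral_rpow_mul_one_sub_rpow_mul_pow (j : ℕ) :
    ∫ t in (0 : ℝ)..1, t ^ (a - 1) * (1 - t) ^ (c - a - 1) * t ^ j =
      ProbabilityTheory.beta a (c - a) *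
        ((ascPochhammer ℝ j).eval a / (ascPochhammer ℝ j).eval c) := by
  have hc : 0 < c := ha.trans hac
  have hneg {s : ℝ} (hs : 0 < s) (k : ℕ) : s ≠ -k := by
    linarith
  calc ∫ t in (0 : ℝ)..1, t ^ (a - 1) * (1 - t) ^ (c - a - 1) * t ^ j
      = ∫ t in (0 : ℝ)..1, t ^ (a + j - 1) * (1 - t) ^ (c - a - 1) := by
        refine intervalIntegral.integral_congr_Ioo_of_le zero_le_one fun t ht => ?_
        rw [mul_right_comm, ← Real.rpow_add_natCast ht.1.ne', sub_add_eq_add_sub]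
    _ = ProbabilityTheory.beta (a + j) (c - a) :=
        (beta_eq_integral (by positivity) (sub_pos.2 hac)).symm
    _ = _ := by
        rw [ProbabilityTheory.beta, ProbabilityTheory.beta, Gamma_add_natCast (hneg ha),
          show a + j + (c - a) = c + j by ring, Gamma_add_natCast (hneg hc), add_sub_cancel]
        ring

lemma beta_mul_ordinaryHypergeometric (b : ℝ) {x : ℂ} (hx : ‖x‖ < 1) :
    (ProbabilityTheory.beta a (c - a) : ℂ) * ordinaryHypergeometric a b c x =
      ∫ t in (0 : ℝ)..1, ((t ^ (a - 1) * (1 - t) ^ (c - a - 1) : ℝ) : ℂ) *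
        (1 - x * t) ^ (-b : ℂ) := by
  have norm_mul_le : ∀ t ∈ Set.uIoc (0 : ℝ) 1, ‖x * t‖ ≤ ‖x‖ := fun t ht => by
    rw [Set.uIoc_of_le zero_le_one] at ht
    rw [norm_mul, Complex.norm_of_nonneg ht.1.le]
    exact mul_le_of_le_one_right (norm_nonneg x) ht.2
  refine ((hasSum_ordinaryHypergeometric a b c hx).mul_left _).unique ?_
  have hw := intervalIntegrable_rpow_mul_one_sub_rpow ha hac
  refine (hasSum_intervalIntegral_mul ⟨hw.1.ofReal, hw.2.ofReal⟩ (fun j => by fun_prop)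
    (fun j t ht => ?_) (hasSum_one_sub_cpow_neg b hx).summable.norm
    (fun t ht => hasSum_one_sub_cpow_neg b ((norm_mul_le t ht).trans_lt hx))).congr_fun
    fun j => ?_
  · rw [norm_mul, norm_mul, norm_pow, norm_pow]
    gcongr
    exact norm_mul_le t ht
  · set p := (ascPochhammer ℝ j).eval b / j.factorial with hp
    calc (ProbabilityTheory.beta a (c - a) : ℂ) *
          (ordinaryHypergeometricCoefficient a b c j • x ^ j)
        = ((∫ t in (0 : ℝ)..1, t ^ (a - 1) * (1 - t) ^ (c - a - 1) * t ^ j : ℝ) : ℂ) *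
          (p * x ^ j) := by
          rw [integral_rpow_mul_one_sub_rpow_mul_pow ha hac, Complex.real_smul,
            ordinaryHypergeometricCoefficient, hp]
          push_cast
          ring
      _ = ∫ t in (0 : ℝ)..1, ((t ^ (a - 1) * (1 - t) ^ (c - a - 1) : ℝ) : ℂ) *
          (p * (x * t) ^ j) := by
          rw [← intervalIntegral.integral_ofReal, ← intervalIntegral.integral_mul_const]
          refine intervalIntegral.integral_congr fun t _ => ?_
          push_cast
          ring

lemma norm_ordinaryHypergeometric_le {b B : ℝ} {x : ℂ} (hx : ‖x‖ < 1)
    (hB : ∀ t ∈ Set.Ioo (0 : ℝ) 1, ‖1 - x * t‖ ^ (-b) ≤ B) :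
    ‖ordinaryHypergeometric a b c x‖ ≤ B := by
  have hbeta := ProbabilityTheory.beta_pos ha (sub_pos.2 hac)
  have hint := intervalIntegrable_rpow_mul_one_sub_rpow ha hac
  refine le_of_mul_le_mul_left ?_ hbeta
  calc ProbabilityTheory.beta a (c - a) * ‖ordinaryHypergeometric a b c x‖
      = ‖∫ t in (0 : ℝ)..1, ((t ^ (a - 1) * (1 - t) ^ (c - a - 1) : ℝ) : ℂ) *
          (1 - x * t) ^ (-b : ℂ)‖ := by
        rw [← beta_mul_ordinaryHypergeometric ha hac b hx, norm_mul,
          Complex.norm_of_nonneg hbeta.le]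
    _ ≤ ∫ t in (0 : ℝ)..1, t ^ (a - 1) * (1 - t) ^ (c - a - 1) * B := by
        refine intervalIntegral.norm_integral_le_of_norm_le zero_le_one ?_ (hint.mul_const B)
        filter_upwards [Measure.ae_ne volume (1 : ℝ)] with t ht_ne ht
        have ht' : t ∈ Set.Ioo (0 : ℝ) 1 := ⟨ht.1, lt_of_le_of_ne ht.2 ht_ne⟩
        have hw : 0 ≤ t ^ (a - 1) * (1 - t) ^ (c - a - 1) :=
          mul_nonneg (Real.rpow_nonneg ht.1.le _) (Real.rpow_nonneg (sub_nonneg.2 ht.2) _)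
        rw [norm_mul, Complex.norm_of_nonneg hw, ← Complex.ofReal_neg, Complex.norm_cpow_real]
        exact mul_le_mul_of_nonneg_left (hB t ht') hw
    _ = ProbabilityTheory.beta a (c - a) * B := by
        rw [intervalIntegral.integral_mul_const, ← beta_eq_integral ha (sub_pos.2 hac)]

end EulerIntegral

section HypergeometricBounds

lemma norm_ordinaryHypergeometric_le_of_coefficient_le {a b c d K : ℝ} {x : ℂ} (hx : ‖x‖ < 1)
    (hcoeff : ∀ j, |ordinaryHypergeometricCoefficient a b c j| ≤
      K * ((ascPochhammer ℝ j).eval d / j.factorial)) :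
    ‖ordinaryHypergeometric a b c x‖ ≤ K * (1 - ‖x‖) ^ (-d) := by
  have hbinomial := (hasSum_one_sub_rpow_neg d (by simpa using hx : |‖x‖| < 1)).mul_left K
  refine (hasSum_ordinaryHypergeometric a b c hx).norm_le_of_bounded hbinomial fun j => ?_
  rw [norm_smul, norm_pow, Real.norm_eq_abs, ← mul_assoc]
  exact mul_le_mul_of_nonneg_right (hcoeff j) (by positivity)

lemma ascPochhammer_eval_add_mul_le {a c s : ℝ} (hc : 0 < c) (hca : c ≤ a) (hs : 0 ≤ s) (j : ℕ) :
    (ascPochhammer ℝ j).eval (a + s) * (ascPochhammer ℝ j).eval c ≤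
      (ascPochhammer ℝ j).eval a * (ascPochhammer ℝ j).eval (c + s) := by
  induction j with
  | zero => simp
  | succ j ih =>
    have ha : 0 < a := hc.trans_le hca
    have hpoch_a := ascPochhammer_pos j a ha
    have hpoch_cs := ascPochhammer_pos j (c + s) (by positivity)
    have hfactor : (a + s + j) * (c + j) ≤ (a + j) * (c + s + j) := by nlinarith
    simp only [ascPochhammer_succ_eval]
    calc _ = (ascPochhammer ℝ j).eval (a + s) * (ascPochhammer ℝ j).eval c *
          ((a + s + j) * (c + j)) := by ring
      _ ≤ (ascPochhammer ℝ j).eval a * (ascPochhammer ℝ j).eval (c + s) *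
          ((a + j) * (c + s + j)) := by gcongr
      _ = _ := by ring

lemma Gamma_add_mul_Gamma_add_le {s d e : ℝ} (hs : 0 < s) (hd : 0 < d) (he : 0 < e) :
    Real.Gamma (s + d) * Real.Gamma (s + e) ≤ Real.Gamma s * Real.Gamma (s + (d + e)) := by
  have hΓ : 0 < Real.Gamma s := Real.Gamma_pos_of_pos hs
  have hΓ' : 0 < Real.Gamma (s + (d + e)) := Real.Gamma_pos_of_pos (by positivity)
  have hΓ_e : 0 < Real.Gamma (s + e) := Real.Gamma_pos_of_pos (by positivity)
  have log_convex {p q : ℝ} (hp : 0 < p) (hq : 0 < q) :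
      Real.Gamma (s + q) ≤
        Real.Gamma s ^ (p / (p + q)) * Real.Gamma (s + (p + q)) ^ (q / (p + q)) := by
    have h := Real.Gamma_mul_add_mul_le_rpow_Gamma_mul_rpow_Gamma (a := p / (p + q))
      (b := q / (p + q)) hs (by positivity : 0 < s + (p + q)) (by positivity) (by positivity)
      (by field_simp)
    rwa [show p / (p + q) * s + q / (p + q) * (s + (p + q)) = s + q by field_simp; ring] at h
  have h_d := log_convex he hd
  have h_e := log_convex hd he
  rw [add_comm e d] at h_d
  refine (mul_le_mul h_d h_e hΓ_e.le (by positivity)).trans_eq ?_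
  rw [mul_mul_mul_comm, ← Real.rpow_add hΓ, ← Real.rpow_add hΓ', ← add_div, ← add_div,
    add_comm e d, div_self (by positivity), Real.rpow_one, Real.rpow_one]

lemma ordinaryHypergeometricCoefficient_nonneg {a b c : ℝ} (ha : 0 < a) (hb : 0 < b) (hc : 0 < c)
    (j : ℕ) : 0 ≤ ordinaryHypergeometricCoefficient a b c j := by
  have hpoch_a := ascPochhammer_pos j a ha
  have hpoch_b := ascPochhammer_pos j b hb
  have hpoch_c := ascPochhammer_pos j c hc
  positivity

lemma ordinaryHypergeometricCoefficient_add_add_le {a b c s : ℝ} (hb : 0 < b) (hc : 0 < c)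
    (hca : c ≤ a) (hs : 0 ≤ s) (j : ℕ) :
    ordinaryHypergeometricCoefficient (a + s) b (c + s) j ≤
      ordinaryHypergeometricCoefficient a b c j := by
  have hpoch_b := ascPochhammer_pos j b hb
  have hpoch_c := ascPochhammer_pos j c hc
  have hpoch_cs := ascPochhammer_pos j (c + s) (by positivity)
  have hratio : (ascPochhammer ℝ j).eval (a + s) * ((ascPochhammer ℝ j).eval (c + s))⁻¹ ≤
      (ascPochhammer ℝ j).eval a * ((ascPochhammer ℝ j).eval c)⁻¹ := by
    rw [← div_eq_mul_inv, ← div_eq_mul_inv, div_le_div_iff₀ hpoch_cs hpoch_c]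
    exact ascPochhammer_eval_add_mul_le hc hca hs j
  have hmul := mul_le_mul_of_nonneg_left hratio
    (by positivity : 0 ≤ (j.factorial : ℝ)⁻¹ * (ascPochhammer ℝ j).eval b)
  rw [ordinaryHypergeometricCoefficient, ordinaryHypergeometricCoefficient]
  linarith

lemma ordinaryHypergeometricCoefficient_le {a b c : ℝ} (hc : 0 < c) (hca : c < a) (hcb : c < b)
    (j : ℕ) :
    ordinaryHypergeometricCoefficient a b c j ≤
      Real.Gamma c * Real.Gamma (a + b - c) / (Real.Gamma a * Real.Gamma b) *
        ((ascPochhammer ℝ j).eval (a + b - c) / j.factorial) := by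
  have hΓ {s : ℝ} (hs : 0 < s) :
      Real.Gamma (s + j) = (ascPochhammer ℝ j).eval s * Real.Gamma s :=
    Gamma_add_natCast (fun k => by linarith) j
  have ha : 0 < a := hc.trans hca
  have hb : 0 < b := hc.trans hcb
  have hpoch_c := ascPochhammer_pos j c hc
  have hΓ_le := Gamma_add_mul_Gamma_add_le (by positivity : 0 < c + j) (sub_pos.2 hca)
    (sub_pos.2 hcb)
  rw [show c + j + (a - c) = a + j by ring, show c + j + (b - c) = b + j by ring,
    show c + j + (a - c + (b - c)) = a + b - c + j by ring, hΓ ha, hΓ hb, hΓ hc,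
    hΓ (by linarith)] at hΓ_le
  rw [ordinaryHypergeometricCoefficient, div_mul_div_comm, mul_assoc, mul_assoc, inv_mul_eq_div,
    ← mul_assoc, ← div_eq_mul_inv, div_div, div_le_div_iff₀ (by positivity) (by positivity)]
  linarith [mul_le_mul_of_nonneg_right hΓ_le (by positivity : (0 : ℝ) ≤ j.factorial)]

lemma norm_ordinaryHypergeometric_le_of_lt {a b c s : ℝ} (hc : 0 < c) (hca : c < a) (hcb : c < b)
    (hs : 0 ≤ s) {x : ℂ} (hx : ‖x‖ < 1) :
    ‖ordinaryHypergeometric (a + s) b (c + s) x‖ ≤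
      Real.Gamma c * Real.Gamma (a + b - c) / (Real.Gamma a * Real.Gamma b) *
        (1 - ‖x‖) ^ (-(a + b - c)) := by
  refine norm_ordinaryHypergeometric_le_of_coefficient_le hx fun j => ?_
  rw [abs_of_nonneg (ordinaryHypergeometricCoefficient_nonneg (by linarith) (hc.trans hcb)
    (by positivity) j)]
  exact (ordinaryHypergeometricCoefficient_add_add_le (hc.trans hcb) hc hca.le hs j).trans
    (ordinaryHypergeometricCoefficient_le hc hca hcb j)

end HypergeometricBounds

/-- The bound for `₂F₁(n + 1, 1 - lam; n + lam + 1; x)` on `‖x‖ ≤ r`, uniform in `n`. -/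
noncomputable def hypergeometricBound (lam r : ℝ) : ℝ :=
  if lam < 0 then
    Real.Gamma (1 + lam) * Real.Gamma (1 - 2 * lam) / Real.Gamma (1 - lam) *
      (1 - r) ^ (2 * lam - 1)
  else if lam ≤ 1 then (1 - r) ^ (lam - 1)
  else (1 + r) ^ (lam - 1)

lemma norm_ordinaryHypergeometric_le_hypergeometricBound {lam : ℝ} (hlam : -(1 / 2) < lam)
    (hlam0 : lam ≠ 0) (n : ℕ) {x : ℂ} (hx : ‖x‖ < 1) :
    ‖ordinaryHypergeometric (n + 1 : ℝ) (1 - lam) (n + lam + 1) x‖ ≤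
      hypergeometricBound lam ‖x‖ := by
  rcases lt_or_gt_of_ne hlam0 with hneg | hpos
  · have h := norm_ordinaryHypergeometric_le_of_lt (a := 1) (b := 1 - lam) (c := 1 + lam)
      (by linarith) (by linarith) (by linarith) n.cast_nonneg hx
    rw [Real.Gamma_one, one_mul, show 1 + (1 - lam) - (1 + lam) = 1 - 2 * lam by ring, neg_sub,
      show 1 + lam + (n : ℝ) = n + lam + 1 by ring, add_comm (1 : ℝ)] at h
    rwa [hypergeometricBound, if_pos hneg]
  · refine norm_ordinaryHypergeometric_le (by positivity) (by linarith) hx fun t ht => ?_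
    have hxt : ‖x * t‖ ≤ ‖x‖ := by
      rw [norm_mul, Complex.norm_of_nonneg ht.1.le]
      exact mul_le_of_le_one_right (norm_nonneg x) ht.2.le
    rw [hypergeometricBound, if_neg hpos.not_gt, neg_sub]
    split_ifs with hle
    · have hlower := norm_sub_norm_le 1 (x * t)
      rw [norm_one] at hlower
      exact Real.rpow_le_rpow_of_nonpos (by linarith) (by linarith) (by linarith)
    · have hupper := norm_sub_le 1 (x * t)
      rw [norm_one] at hupper
      exact Real.rpow_le_rpow (norm_nonneg _) (by linarith) (by linarith)

section ConnectionCoefficient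

/-- The constant in the estimate `|Γ(lam) k! / Γ(k + lam)| ≤ C k ^ (1 - lam)`. -/
noncomputable def gegenbauerConnectionFactor (lam : ℝ) : ℝ :=
  if lam < 0 then |Real.Gamma lam| else if lam ≤ 1 then 1 / lam else Real.Gamma lam

lemma Gamma_mul_rpow_le_Gamma_add {x t : ℝ} (hx : 0 < x) (hxt : 0 < x + t) (ht : t < 0 ∨ 1 ≤ t) :
    Real.Gamma x * x ^ t ≤ Real.Gamma (x + t) := by
  have hG := Real.Gamma_pos_of_pos hx
  have hlog : Real.log (Real.Gamma (x + 1)) - Real.log (Real.Gamma x) = Real.log x := by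
    rw [Real.Gamma_add_one hx.ne', Real.log_mul hx.ne' hG.ne', add_sub_cancel_right]
  have hx1 : 0 < x + 1 := by positivity
  -- By convexity of `log ∘ Γ`, the slopes of its chords through `x` increase.
  have hslope : t * Real.log x ≤ Real.log (Real.Gamma (x + t)) - Real.log (Real.Gamma x) := by
    rcases ht with ht | ht
    · have h := Real.convexOn_log_Gamma.secant_mono (a := x) (x := x + t) (y := x + 1)
        hx hxt hx1 (by linarith) (by linarith) (by linarith)
      simp only [Function.comp_apply, add_sub_cancel_left, hlog, div_one] at h
      linarith [(div_le_iff_of_neg ht).1 h]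
    · have h := Real.convexOn_log_Gamma.secant_mono (a := x) (x := x + 1) (y := x + t)
        hx hx1 hxt (by linarith) (by linarith) (by linarith)
      simp only [Function.comp_apply, add_sub_cancel_left, hlog, div_one] at h
      linarith [(le_div_iff₀ (by linarith)).1 h]
  rw [← Real.log_le_log_iff (by positivity) (Real.Gamma_pos_of_pos hxt),
    Real.log_mul hG.ne' (by positivity), Real.log_rpow hx]
  linarith

lemma rpow_one_sub_mul_add_one_le {x t : ℝ} (hx : 0 < x) (ht0 : 0 ≤ t) (ht1 : t ≤ 1) :
    x ^ (1 - t) * (x + 1) ≤ (x + 1) ^ (1 - t) * (x + t) := by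
  have hbernoulli : (1 + 1 / x) ^ t ≤ 1 + t * (1 / x) :=
    rpow_one_add_le_one_add_mul_self (by linarith [one_div_pos.2 hx]) ht0 ht1
  have hx1 : x + 1 = x * (1 + 1 / x) := by field_simp
  have hs : (1 + 1 / x) ^ (1 - t) * (1 + 1 / x) ^ t = 1 + 1 / x := by
    rw [← Real.rpow_add (by positivity), sub_add_cancel, Real.rpow_one]
  calc x ^ (1 - t) * (x + 1)
      = (x + 1) ^ (1 - t) * (x * (1 + 1 / x) ^ t) := by
        rw [hx1, Real.mul_rpow hx.le (by positivity)]
        linear_combination -(x ^ (1 - t) * x) * hs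
    _ ≤ (x + 1) ^ (1 - t) * (x * (1 + t * (1 / x))) := by gcongr
    _ = (x + 1) ^ (1 - t) * (x + t) := by field_simp

lemma Gamma_add_one_mul_factorial_le {t : ℝ} (ht0 : 0 < t) (ht1 : t ≤ 1) {k : ℕ} (hk : 1 ≤ k) :
    Real.Gamma (t + 1) * k.factorial ≤ (k : ℝ) ^ (1 - t) * Real.Gamma (k + t) := by
  induction k, hk using Nat.le_induction with
  | base => simp [add_comm]
  | succ k hk ih =>
    have hk0 : (0 : ℝ) < k := by exact_mod_cast hk
    have hG := Real.Gamma_pos_of_pos (show 0 < k + t by positivity)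
    push_cast [Nat.factorial_succ]
    calc Real.Gamma (t + 1) * ((k + 1) * k.factorial)
        = (k + 1) * (Real.Gamma (t + 1) * k.factorial) := by ring
      _ ≤ (k + 1) * ((k : ℝ) ^ (1 - t) * Real.Gamma (k + t)) := by gcongr
      _ = (k : ℝ) ^ (1 - t) * (k + 1) * Real.Gamma (k + t) := by ring
      _ ≤ (k + 1 : ℝ) ^ (1 - t) * (k + t) * Real.Gamma (k + t) := by
        exact mul_le_mul_of_nonneg_right (rpow_one_sub_mul_add_one_le hk0 ht0.le ht1) hG.le
      _ = (k + 1 : ℝ) ^ (1 - t) * Real.Gamma (k + 1 + t) := by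
        rw [add_right_comm, Real.Gamma_add_one (by positivity), mul_assoc]

lemma factorial_le_rpow_mul_Gamma {t : ℝ} {k : ℕ} (hk : 1 ≤ k) (hkt : 0 < k + t)
    (ht : t < 0 ∨ 1 ≤ t) : (k.factorial : ℝ) ≤ (k : ℝ) ^ (1 - t) * Real.Gamma (k + t) := by
  have hk0 : (0 : ℝ) < k := by exact_mod_cast hk
  calc (k.factorial : ℝ) = (k : ℝ) ^ (1 - t) * (Real.Gamma k * (k : ℝ) ^ t) := by
        rw [← Real.Gamma_nat_eq_factorial, Real.Gamma_add_one hk0.ne', Real.rpow_sub hk0,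
          Real.rpow_one]
        field_simp
    _ ≤ (k : ℝ) ^ (1 - t) * Real.Gamma (k + t) := by
        gcongr
        exact Gamma_mul_rpow_le_Gamma_add hk0 hkt ht

lemma abs_gegenbauerConnection_le {lam : ℝ} (hlam : -(1 / 2) < lam) (hlam0 : lam ≠ 0) {k : ℕ}
    (hk : 1 ≤ k) :
    |gegenbauerConnection lam k| ≤ gegenbauerConnectionFactor lam * (k : ℝ) ^ (1 - lam) := by
  have hk1 : (1 : ℝ) ≤ k := by exact_mod_cast hk
  have hkl : 0 < k + lam := by linarith
  have hG := Real.Gamma_pos_of_pos hkl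
  rw [gegenbauerConnection, abs_div, abs_mul, abs_of_pos hG, Nat.abs_cast, div_le_iff₀ hG,
    gegenbauerConnectionFactor, mul_assoc]
  split_ifs with hneg hle
  · gcongr
    exact factorial_le_rpow_mul_Gamma hk hkl (.inl hneg)
  · have hpos : 0 < lam := lt_of_le_of_ne (not_lt.1 hneg) hlam0.symm
    have h := Gamma_add_one_mul_factorial_le hpos hle hk
    rw [Real.Gamma_add_one hlam0] at h
    rw [abs_of_pos (Real.Gamma_pos_of_pos hpos), one_div_mul_eq_div, le_div_iff₀ hpos]
    linarith
  · have hlt : 1 < lam := not_le.1 hle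
    have hGlam := Real.Gamma_pos_of_pos (zero_lt_one.trans hlt)
    rw [abs_of_pos hGlam]
    gcongr
    exact factorial_le_rpow_mul_Gamma hk hkl (.inr hlt.le)

lemma gegenbauerConnection_zero {lam : ℝ} (hlam : -1 < lam) (hlam0 : lam ≠ 0) :
    gegenbauerConnection lam 0 = 1 := by
  simp [gegenbauerConnection, Real.Gamma_ne_zero (ne_neg_natCast hlam hlam0)]

lemma gegenbauerConnectionFactor_mul_gegenbauerZeroFactor {lam : ℝ} (hlam : -1 < lam)
    (hlam0 : lam ≠ 0) : gegenbauerConnectionFactor lam * gegenbauerZeroFactor lam = 1 := by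
  have hG : Real.Gamma lam ≠ 0 := Real.Gamma_ne_zero (ne_neg_natCast hlam hlam0)
  rw [gegenbauerConnectionFactor, gegenbauerZeroFactor]
  split_ifs <;> field_simp

end ConnectionCoefficient

lemma gegenbauerD_eq (f : ℂ → ℂ) (lam ρ : ℝ) :
    gegenbauerD f lam ρ = bernsteinMax f ρ * bernsteinLength ρ / (Real.pi * ρ) *
      (gegenbauerConnectionFactor lam * hypergeometricBound lam (1 / ρ ^ 2)) := by
  rw [gegenbauerD, gegenbauerConnectionFactor, hypergeometricBound]
  split_ifs <;> ring

section LaurentSeries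

/-- The `m`-th Laurent coefficient of `g`, computed on the circle `|u| = r`. -/
noncomputable def laurentCoeff (g : ℂ → ℂ) (r : ℝ) (m : ℤ) : ℂ :=
  Real.circleAverage (fun u => u ^ (-m) * g u) 0 r

variable {g : ℂ → ℂ} {r R : ℝ}

lemma laurentCoeff_eq_of_differentiableAt_annulus (hr : 0 < r) (hrR : r ≤ R)
    (hgc : ContinuousOn g (Metric.closedBall 0 R \ Metric.ball 0 r))
    (hgd : ∀ u ∈ Metric.ball 0 R \ Metric.closedBall 0 r, DifferentiableAt ℂ g u) (m : ℤ) :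
    laurentCoeff g R m = laurentCoeff g r m := by
  rw [laurentCoeff, laurentCoeff, Real.circleAverage_eq_circleIntegral hr.ne',
    Real.circleAverage_eq_circleIntegral (hr.trans_le hrR).ne']
  congr 1
  refine Complex.circleIntegral_sub_center_inv_smul_eq_of_differentiable_on_annulus_off_countable
    hr hrR Set.countable_empty ?_ ?_
  · refine (continuousOn_id.zpow₀ _ fun u hu => .inl ?_).mul hgc
    rintro rfl
    exact hu.2 (Metric.mem_ball_self hr)
  · rintro u ⟨hu, -⟩
    have hu0 : u ≠ 0 := by
      rintro rfl
      exact hu.2 (Metric.mem_closedBall_self hr.le)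
    exact (differentiableAt_id.zpow (.inl hu0)).mul (hgd u hu)

lemma norm_laurentCoeff_le {M : ℝ} (hr : 0 < r) (hg : ∀ u, ‖u‖ = r → ‖g u‖ ≤ M) (m : ℤ) :
    ‖laurentCoeff g r m‖ ≤ M * r ^ (-m) := by
  have h := intervalIntegral.norm_integral_le_of_norm_le_const (a := 0) (b := 2 * Real.pi)
    (f := fun θ => circleMap 0 r θ ^ (-m) * g (circleMap 0 r θ)) (C := M * r ^ (-m))
    fun θ _ => by
      rw [norm_mul, norm_zpow, norm_circleMap_zero, abs_of_pos hr, mul_comm]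
      gcongr
      exact hg _ (by rw [norm_circleMap_zero, abs_of_pos hr])
  rw [sub_zero, abs_of_pos Real.two_pi_pos] at h
  rw [laurentCoeff, Real.circleAverage_def, norm_smul, norm_inv,
    Real.norm_of_nonneg Real.two_pi_pos.le, inv_mul_le_iff₀ Real.two_pi_pos]
  linarith

lemma laurentCoeff_one_neg (hg : ∀ u, g u⁻¹ = g u) (m : ℤ) :
    laurentCoeff g 1 (-m) = laurentCoeff g 1 m := by
  rw [laurentCoeff, ← Real.circleAverage_zero_one_congr_inv, laurentCoeff]
  simp only [inv_zpow', hg, neg_neg]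

lemma fourier_coe_eq_circleMap_zpow (m : ℤ) (θ : ℝ) :
    fourier m (θ : AddCircle (2 * Real.pi)) = circleMap 0 1 θ ^ m := by
  rw [fourier_coe_apply, circleMap_zero, Complex.ofReal_one, one_mul, ← Complex.exp_int_mul]
  congr 1
  push_cast
  field_simp

lemma hasSum_laurentCoeff_one (hg : ContinuousOn g (Metric.sphere 0 1))
    (hsum : Summable (laurentCoeff g 1)) (θ : ℝ) :
    HasSum (fun m : ℤ => laurentCoeff g 1 m * circleMap 0 1 θ ^ m) (g (circleMap 0 1 θ)) := by
  have : Fact (0 < 2 * Real.pi) := ⟨Real.two_pi_pos⟩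
  let G : C(AddCircle (2 * Real.pi), ℂ) :=
    ⟨fun t => g (fourier 1 t), hg.comp_continuous (fourier 1).continuous fun t => by
      rw [mem_sphere_zero_iff_norm, fourier_apply]
      exact Circle.norm_coe _⟩
  have hG : ∀ φ : ℝ, G (φ : AddCircle (2 * Real.pi)) = g (circleMap 0 1 φ) := fun φ =>
    congrArg g ((fourier_coe_eq_circleMap_zpow 1 φ).trans (zpow_one _))
  have hcoeff : fourierCoeff G = laurentCoeff g 1 := by
    ext m
    simp only [fourierCoeff_eq_intervalIntegral _ _ 0, zero_add, laurentCoeff,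
      Real.circleAverage_def, hG, fourier_coe_eq_circleMap_zpow, smul_eq_mul, one_div]
  have h := has_pointwise_sum_fourier_series_of_summable (f := G) (hcoeff ▸ hsum) θ
  simpa only [hG, hcoeff, fourier_coe_eq_circleMap_zpow, smul_eq_mul] using h

end LaurentSeries

section JoukowskiMap

/-- The Joukowski map `u ↦ (u + u⁻¹) / 2`, which takes the circle `|u| = ρ` to the Bernstein
ellipse of parameter `ρ`. -/
noncomputable def joukowski (u : ℂ) : ℂ := (u + u⁻¹) / 2

lemma joukowski_inv (u : ℂ) : joukowski u⁻¹ = joukowski u := by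
  rw [joukowski, joukowski, inv_inv, add_comm]

lemma joukowski_circleMap (ρ θ : ℝ) : joukowski (circleMap 0 ρ θ) = bernsteinParam ρ θ := rfl

lemma joukowski_circleMap_one (θ : ℝ) : joukowski (circleMap 0 1 θ) = Real.cos θ := by
  rw [joukowski, circleMap_zero, Complex.ofReal_one, one_mul, ← Complex.exp_neg, Complex.ofReal_cos,
    Complex.cos, neg_mul]

lemma hasDerivAt_joukowski {u : ℂ} (hu : u ≠ 0) :
    HasDerivAt joukowski ((1 - (u ^ 2)⁻¹) / 2) u :=
  (((hasDerivAt_id u).add (hasDerivAt_inv hu)).div_const 2).congr_deriv (by ring)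

lemma norm_joukowski_sub_one_add_norm_joukowski_add_one {u : ℂ} (hu : u ≠ 0) :
    ‖joukowski u - 1‖ + ‖joukowski u + 1‖ = ‖u‖ + ‖u‖⁻¹ := by
  have hsub : joukowski u - 1 = (u - 1) ^ 2 / (2 * u) := by rw [joukowski]; field_simp; ring
  have hadd : joukowski u + 1 = (u + 1) ^ 2 / (2 * u) := by rw [joukowski]; field_simp; ring
  have hn : ‖u‖ ≠ 0 := norm_ne_zero_iff.2 hu
  have hp := parallelogram_law_with_norm ℝ u 1
  rw [norm_one] at hp
  rw [hsub, hadd]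
  simp only [norm_div, norm_pow, norm_mul, Complex.norm_ofNat]
  field_simp
  linarith

lemma joukowski_mem_bernsteinEllipse (u : ℂ) : joukowski u ∈ bernsteinEllipse ‖u‖ :=
  ⟨u, rfl, rfl⟩

lemma joukowski_mem_bernsteinInterior {ρ : ℝ} {u : ℂ} (hu : 1 ≤ ‖u‖) (huρ : ‖u‖ < ρ) :
    joukowski u ∈ bernsteinInterior ρ := by
  have hu_pos : 0 < ‖u‖ := by linarith
  have hρ_pos : 0 < ρ := by linarith
  rw [bernsteinInterior, Set.mem_ofPred_eq,
    norm_joukowski_sub_one_add_norm_joukowski_add_one (norm_pos_iff.1 hu_pos), ← sub_pos]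
  have hfactor : ρ + ρ⁻¹ - (‖u‖ + ‖u‖⁻¹) = (ρ - ‖u‖) * (ρ * ‖u‖ - 1) / (ρ * ‖u‖) := by
    field_simp
    ring
  rw [hfactor]
  exact div_pos (mul_pos (by linarith) (by nlinarith)) (mul_pos hρ_pos hu_pos)

lemma bernsteinEllipse_eq_image_joukowski (ρ : ℝ) :
    bernsteinEllipse ρ = joukowski '' Metric.sphere 0 ρ := by
  ext z
  simp only [bernsteinEllipse, joukowski, Set.mem_ofPred_eq, Set.mem_image,
    mem_sphere_zero_iff_norm, eq_comm (a := z)]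

lemma isCompact_bernsteinEllipse {ρ : ℝ} (hρ : ρ ≠ 0) : IsCompact (bernsteinEllipse ρ) := by
  rw [bernsteinEllipse_eq_image_joukowski]
  refine (isCompact_sphere _ _).image_of_continuousOn fun u hu => ?_
  exact (hasDerivAt_joukowski
    (ne_zero_of_mem_sphere hρ ⟨u, hu⟩)).continuousAt.continuousWithinAt

lemma norm_le_bernsteinMax {f : ℂ → ℂ} {ρ : ℝ} (hρ : ρ ≠ 0)
    (hf : ContinuousOn f (bernsteinEllipse ρ)) {z : ℂ} (hz : z ∈ bernsteinEllipse ρ) :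
    ‖f z‖ ≤ bernsteinMax f ρ :=
  le_csSup ((isCompact_bernsteinEllipse hρ).image_of_continuousOn hf.norm).bddAbove
    ⟨z, hz, rfl⟩

variable {f : ℂ → ℂ} {ρ : ℝ}

lemma continuousOn_comp_joukowski
    (hfc : ContinuousOn f (bernsteinInterior ρ ∪ bernsteinEllipse ρ)) :
    ContinuousOn (fun u => f (joukowski u)) (Metric.closedBall 0 ρ \ Metric.ball 0 1) := by
  refine hfc.comp (fun u hu => ?_) fun u hu => ?_ <;>
    rw [Set.mem_sdiff, mem_closedBall_zero_iff, mem_ball_zero_iff, not_lt] at hu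
  · exact (hasDerivAt_joukowski
      (norm_pos_iff.1 (by linarith))).continuousAt.continuousWithinAt
  · rcases hu.1.lt_or_eq with h | rfl
    · exact .inl (joukowski_mem_bernsteinInterior hu.2 h)
    · exact .inr (joukowski_mem_bernsteinEllipse u)

lemma differentiableAt_comp_joukowski (hf : AnalyticOnNhd ℂ f (bernsteinInterior ρ)) {u : ℂ}
    (hu : 1 ≤ ‖u‖) (huρ : ‖u‖ < ρ) : DifferentiableAt ℂ (fun v => f (joukowski v)) u :=
  (hf _ (joukowski_mem_bernsteinInterior hu huρ)).differentiableAt.comp u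
    (hasDerivAt_joukowski (norm_pos_iff.1 (by linarith))).differentiableAt

variable (hρ : 1 < ρ) (hf : AnalyticOnNhd ℂ f (bernsteinInterior ρ))
  (hfc : ContinuousOn f (bernsteinInterior ρ ∪ bernsteinEllipse ρ))
include hρ hf hfc

lemma laurentCoeff_comp_joukowski_eq (m : ℤ) :
    laurentCoeff (fun u => f (joukowski u)) ρ m = laurentCoeff (fun u => f (joukowski u)) 1 m :=
  laurentCoeff_eq_of_differentiableAt_annulus one_pos hρ.le (continuousOn_comp_joukowski hfc)
    (fun u hu => by
      simp only [Set.mem_sdiff, mem_ball_zero_iff, mem_closedBall_zero_iff, not_le] at hu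
      exact differentiableAt_comp_joukowski hf hu.2.le hu.1) m

lemma norm_laurentCoeff_comp_joukowski_le (m : ℕ) :
    ‖laurentCoeff (fun u => f (joukowski u)) 1 m‖ ≤ bernsteinMax f ρ * ρ⁻¹ ^ m := by
  have hρ0 : 0 < ρ := by linarith
  rw [← laurentCoeff_comp_joukowski_eq hρ hf hfc, inv_pow, ← zpow_natCast, ← zpow_neg]
  refine norm_laurentCoeff_le hρ0 (fun u hu => ?_) m
  exact norm_le_bernsteinMax hρ0.ne' (hfc.mono Set.subset_union_right)
    (hu ▸ joukowski_mem_bernsteinEllipse u)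

lemma summable_norm_laurentCoeff_comp_joukowski_mul :
    Summable fun m : ℕ => ‖laurentCoeff (fun u => f (joukowski u)) 1 m‖ * (m + 1) := by
  have hr : ‖ρ⁻¹‖ < 1 := by
    rw [norm_inv, Real.norm_of_nonneg (by linarith)]
    exact inv_lt_one_of_one_lt₀ hρ
  have hgeom := (summable_pow_mul_geometric_of_norm_lt_one 1 hr).add
    (summable_geometric_of_norm_lt_one hr)
  refine .of_nonneg_of_le (fun m => by positivity) (fun m => ?_)
    (hgeom.mul_left (bernsteinMax f ρ))
  calc _ ≤ bernsteinMax f ρ * ρ⁻¹ ^ m * (m + 1) := by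
        gcongr
        exact norm_laurentCoeff_comp_joukowski_le hρ hf hfc m
    _ = _ := by ring

lemma summable_laurentCoeff_comp_joukowski :
    Summable (laurentCoeff (fun u => f (joukowski u)) 1) := by
  have h : Summable fun m : ℕ => laurentCoeff (fun u => f (joukowski u)) 1 m := by
    refine .of_norm_bounded (summable_norm_laurentCoeff_comp_joukowski_mul hρ hf hfc) fun m => ?_
    exact le_mul_of_one_le_right (norm_nonneg _) (by simp)
  exact h.of_nat_of_neg (by
    simpa only [laurentCoeff_one_neg
      (g := fun u => f (joukowski u)) fun u => by rw [joukowski_inv]] using h)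

end JoukowskiMap

section ChebyshevSeries

lemma abs_eval_chebyshevU_le {x : ℝ} (hx : |x| ≤ 1) (m : ℕ) :
    |(Chebyshev.U ℝ m).eval x| ≤ m + 1 := by
  induction m using Nat.twoStepInduction with
  | zero => simp
  | one =>
    simp only [Nat.cast_one, Chebyshev.U_one, eval_mul, eval_ofNat, eval_X, abs_mul, abs_two]
    linarith
  | more m ih _ =>
    have hrec := congrArg (eval x) (Chebyshev.U_eq_two_mul_T_add_U ℝ m)
    have hT := Chebyshev.abs_eval_T_real_le_one (m + 2) hx
    simp only [eval_add, eval_mul, eval_ofNat] at hrec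
    push_cast
    rw [hrec]
    refine (abs_add_le _ _).trans ?_
    rw [abs_mul, abs_two]
    linarith

lemma hasSum_chebyshevU_of_hasSum_chebyshevT {c : ℕ → ℂ} {x : ℝ} (hx : |x| ≤ 1)
    (hc : Summable fun m => ‖c m‖ * (m + 1)) {s : ℂ}
    (hs : HasSum (fun m : ℕ => c m * (2 * ((Chebyshev.T ℝ m).eval x : ℝ))) (s + c 0)) :
    HasSum (fun m : ℕ => (c m - c (m + 2)) * ((Chebyshev.U ℝ m).eval x : ℝ)) s := by
  have hU : Summable fun m : ℕ => c m * ((Chebyshev.U ℝ m).eval x : ℝ) := by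
    refine .of_norm_bounded hc fun m => ?_
    rw [norm_mul, Complex.norm_real, Real.norm_eq_abs]
    exact mul_le_mul_of_nonneg_left (abs_eval_chebyshevU_le hx m) (norm_nonneg _)
  have hUT : ∀ m : ℕ, c m * ((Chebyshev.U ℝ m).eval x : ℝ) -
      c m * (2 * ((Chebyshev.T ℝ m).eval x : ℝ)) =
      c m * ((Chebyshev.U ℝ ((m : ℤ) - 2)).eval x : ℝ) := fun m => by
    have h := congrArg (eval x) (Chebyshev.two_mul_T_eq_U_sub_U (R := ℝ) ((m : ℤ) - 2))
    simp only [eval_sub, eval_mul, eval_ofNat, sub_add_cancel] at h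
    rw [eq_sub_of_add_eq' (eq_sub_iff_add_eq.1 h)]
    push_cast
    ring
  have hshift := hU.hasSum.sub hs
  simp only [hUT] at hshift
  have h := hU.hasSum.sub ((hasSum_nat_add_iff' 2).2 hshift)
  have hvalue : ∀ S : ℂ, S - (S - (s + c 0) - ∑ i ∈ Finset.range 2,
      c i * ((Chebyshev.U ℝ ((i : ℤ) - 2)).eval x : ℝ)) = s := fun S => by
    simp only [Finset.sum_range_succ, Finset.range_one, Finset.sum_singleton, Nat.cast_zero,
      Nat.cast_one, zero_sub, Int.reduceSub, Chebyshev.U_neg_two, Chebyshev.U_neg_one, eval_neg,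
      eval_one, eval_zero, Complex.ofReal_neg, Complex.ofReal_one, Complex.ofReal_zero]
    ring
  rw [hvalue] at h
  refine h.congr_fun fun m => ?_
  push_cast
  rw [add_sub_cancel_right]
  ring

end ChebyshevSeries

section ContourIntegral

lemma deriv_bernsteinParam {ρ : ℝ} (hρ : ρ ≠ 0) (θ : ℝ) :
    deriv (bernsteinParam ρ) θ =
      Complex.I * (circleMap 0 ρ θ - (circleMap 0 ρ θ)⁻¹) / 2 := by
  have hu : circleMap 0 ρ θ ≠ 0 := circleMap_ne_center hρ
  have h : HasDerivAt (bernsteinParam ρ) _ θ :=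
    (hasDerivAt_joukowski hu).comp θ (hasDerivAt_circleMap 0 ρ θ)
  rw [h.deriv, ← circleMap_sub_center, sub_zero]
  field_simp

lemma continuous_inv_circleMap {ρ : ℝ} (hρ : ρ ≠ 0) :
    Continuous fun θ => (circleMap 0 ρ θ)⁻¹ :=
  (continuous_circleMap 0 ρ).inv₀ fun _ => circleMap_ne_center hρ

lemma continuous_deriv_bernsteinParam {ρ : ℝ} (hρ : ρ ≠ 0) :
    Continuous (deriv (bernsteinParam ρ)) := by
  rw [funext (deriv_bernsteinParam hρ)]
  exact (continuous_const.mul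
    ((continuous_circleMap 0 ρ).sub (continuous_inv_circleMap hρ))).div_const 2

/-- The contour integral `(1 / πi) ∮ f(z) φ(u) dz` over the Bernstein ellipse, with
`z = (u + u⁻¹) / 2` and `|u| = ρ`. -/
noncomputable def bernsteinIntegral (f : ℂ → ℂ) (ρ : ℝ) (φ : ℂ → ℂ) : ℂ :=
  (Real.pi * Complex.I)⁻¹ * ∫ θ in (0 : ℝ)..2 * Real.pi,
    f (bernsteinParam ρ θ) * deriv (bernsteinParam ρ) θ * φ (circleMap 0 ρ θ)

lemma bernsteinIntegral_const_mul (f : ℂ → ℂ) (ρ : ℝ) (a : ℂ) (φ : ℂ → ℂ) :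
    bernsteinIntegral f ρ (fun u => a * φ u) = a * bernsteinIntegral f ρ φ := by
  simp only [bernsteinIntegral, mul_left_comm _ a, intervalIntegral.integral_const_mul]

lemma bernsteinLength_nonneg (ρ : ℝ) : 0 ≤ bernsteinLength ρ :=
  intervalIntegral.integral_nonneg Real.two_pi_pos.le fun _ _ => norm_nonneg _

lemma bernsteinParam_mem_bernsteinEllipse {ρ : ℝ} (hρ : 0 < ρ) (θ : ℝ) :
    bernsteinParam ρ θ ∈ bernsteinEllipse ρ :=
  ⟨circleMap 0 ρ θ, by rw [norm_circleMap_zero, abs_of_pos hρ], rfl⟩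

variable {f : ℂ → ℂ} {ρ : ℝ} (hρ : 0 < ρ) (hf : ContinuousOn f (bernsteinEllipse ρ))
include hρ hf

lemma bernsteinMax_nonneg : 0 ≤ bernsteinMax f ρ :=
  (norm_nonneg _).trans
    (norm_le_bernsteinMax hρ.ne' hf (bernsteinParam_mem_bernsteinEllipse hρ 0))

lemma continuous_comp_bernsteinParam : Continuous fun θ => f (bernsteinParam ρ θ) :=
  hf.comp_continuous
    (((continuous_circleMap 0 ρ).add (continuous_inv_circleMap hρ.ne')).div_const 2)
    (bernsteinParam_mem_bernsteinEllipse hρ)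

lemma norm_bernsteinIntegral_le {φ : ℂ → ℂ} {C : ℝ} (hφ : ∀ u, ‖u‖ = ρ → ‖φ u‖ ≤ C) :
    ‖bernsteinIntegral f ρ φ‖ ≤ bernsteinMax f ρ * bernsteinLength ρ / Real.pi * C := by
  have hM := bernsteinMax_nonneg hρ hf
  have hbound : ∀ θ, ‖f (bernsteinParam ρ θ) * deriv (bernsteinParam ρ) θ *
      φ (circleMap 0 ρ θ)‖ ≤ bernsteinMax f ρ * ‖deriv (bernsteinParam ρ) θ‖ * C := fun θ => by
    rw [norm_mul, norm_mul]
    gcongr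
    · exact norm_le_bernsteinMax hρ.ne' hf (bernsteinParam_mem_bernsteinEllipse hρ θ)
    · exact hφ _ (by rw [norm_circleMap_zero, abs_of_pos hρ])
  have hcont : Continuous fun θ => bernsteinMax f ρ * ‖deriv (bernsteinParam ρ) θ‖ * C :=
    (continuous_const.mul (continuous_deriv_bernsteinParam hρ.ne').norm).mul continuous_const
  have h := intervalIntegral.norm_integral_le_of_norm_le (μ := volume) Real.two_pi_pos.le
    (.of_forall fun θ _ => hbound θ) (hcont.intervalIntegrable _ _)
  rw [intervalIntegral.integral_mul_const, intervalIntegral.integral_const_mul,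
    ← bernsteinLength] at h
  rw [bernsteinIntegral, norm_mul, norm_inv, norm_mul, Complex.norm_I, mul_one,
    Complex.norm_of_nonneg Real.pi_pos.le]
  calc _ ≤ Real.pi⁻¹ * (bernsteinMax f ρ * bernsteinLength ρ * C) := by gcongr
    _ = _ := by ring

lemma hasSum_bernsteinIntegral {F : ℕ → ℂ → ℂ} {φ : ℂ → ℂ} {B : ℕ → ℝ}
    (hF : ∀ j, ContinuousOn (F j) (Metric.sphere 0 ρ)) (hFB : ∀ j u, ‖u‖ = ρ → ‖F j u‖ ≤ B j)
    (hB : Summable B) (hφ : ∀ u, ‖u‖ = ρ → HasSum (F · u) (φ u)) :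
    HasSum (fun j => bernsteinIntegral f ρ (F j)) (bernsteinIntegral f ρ φ) := by
  have hcircle : ∀ θ, ‖circleMap 0 ρ θ‖ = ρ := fun θ => by
    rw [norm_circleMap_zero, abs_of_pos hρ]
  exact (hasSum_intervalIntegral_mul
    (((continuous_comp_bernsteinParam hρ hf).mul
      (continuous_deriv_bernsteinParam hρ.ne')).intervalIntegrable _ _)
    (fun j => (hF j).comp_continuous (continuous_circleMap 0 ρ) fun θ =>
      mem_sphere_zero_iff_norm.2 (hcircle θ))
    (fun j θ _ => hFB j _ (hcircle θ)) hB fun θ _ => hφ _ (hcircle θ)).mul_left _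

lemma laurentCoeff_comp_joukowski_sub (m : ℕ) :
    laurentCoeff (fun u => f (joukowski u)) ρ m -
      laurentCoeff (fun u => f (joukowski u)) ρ (m + 2 : ℕ) =
      bernsteinIntegral f ρ (fun u => u⁻¹ ^ (m + 1)) := by
  have hint : ∀ n : ℕ, IntervalIntegrable (fun θ =>
      circleMap 0 ρ θ ^ (-n : ℤ) * f (joukowski (circleMap 0 ρ θ))) volume 0 (2 * Real.pi) :=
    fun n => by
      simp only [zpow_neg, zpow_natCast, ← inv_pow]
      exact (((continuous_inv_circleMap hρ.ne').pow n).mul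
        (continuous_comp_bernsteinParam hρ hf)).intervalIntegrable _ _
  simp only [laurentCoeff, Real.circleAverage_def]
  rw [← smul_sub, ← intervalIntegral.integral_sub (hint _) (hint _), bernsteinIntegral,
    Complex.real_smul, ← intervalIntegral.integral_const_mul,
    ← intervalIntegral.integral_const_mul]
  congr 1
  ext θ
  have hu : circleMap 0 ρ θ ≠ 0 := circleMap_ne_center hρ.ne'
  rw [deriv_bernsteinParam hρ.ne', joukowski_circleMap]
  simp only [zpow_neg, zpow_natCast, inv_pow]
  push_cast
  field_simp
  ring

end ContourIntegral

section ChebyshevExpansion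

variable {f : ℂ → ℂ} {ρ : ℝ} (hρ : 1 < ρ) (hf : AnalyticOnNhd ℂ f (bernsteinInterior ρ))
  (hfc : ContinuousOn f (bernsteinInterior ρ ∪ bernsteinEllipse ρ))
include hρ hf hfc

lemma hasSum_laurentCoeff_mul_chebyshevT {x : ℝ} (hx : |x| ≤ 1) :
    HasSum (fun m : ℕ => laurentCoeff (fun u => f (joukowski u)) 1 m *
      (2 * ((Chebyshev.T ℝ m).eval x : ℝ)))
      (f x + laurentCoeff (fun u => f (joukowski u)) 1 0) := by
  have hcos : Real.cos (Real.arccos x) = x :=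
    Real.cos_arccos (neg_le_of_abs_le hx) (le_of_abs_le hx)
  have hsphere : Metric.sphere (0 : ℂ) 1 ⊆ Metric.closedBall 0 ρ \ Metric.ball 0 1 := fun u hu => by
    rw [mem_sphere_zero_iff_norm] at hu
    simp [hu, hρ.le]
  have h := (hasSum_laurentCoeff_one ((continuousOn_comp_joukowski hfc).mono hsphere)
    (summable_laurentCoeff_comp_joukowski hρ hf hfc) (Real.arccos x)).nat_add_neg
  rw [joukowski_circleMap_one, hcos, zpow_zero, mul_one] at h
  refine h.congr_fun fun m => ?_
  rw [laurentCoeff_one_neg (g := fun u => f (joukowski u)) (fun u => by rw [joukowski_inv]),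
    ← mul_add]
  congr 1
  have hT := Chebyshev.T_real_cos (Real.arccos x) m
  rw [hcos] at hT
  rw [hT, zpow_neg, zpow_natCast, circleMap_zero, Complex.ofReal_one, one_mul,
    ← Complex.exp_nat_mul, ← Complex.exp_neg, Complex.ofReal_cos, Complex.two_cos]
  push_cast
  ring_nf

lemma hasSum_bernsteinIntegral_mul_chebyshevU {x : ℝ} (hx : |x| ≤ 1) :
    HasSum (fun m : ℕ => bernsteinIntegral f ρ (fun u => u⁻¹ ^ (m + 1)) *
      ((Chebyshev.U ℝ m).eval x : ℝ)) (f x) := by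
  simp only [← laurentCoeff_comp_joukowski_sub (zero_lt_one.trans hρ)
    (hfc.mono Set.subset_union_right), laurentCoeff_comp_joukowski_eq hρ hf hfc]
  exact hasSum_chebyshevU_of_hasSum_chebyshevT hx
    (summable_norm_laurentCoeff_comp_joukowski_mul hρ hf hfc)
    (hasSum_laurentCoeff_mul_chebyshevT hρ hf hfc hx)

end ChebyshevExpansion

section GegenbauerCoefficients

variable {f : ℂ → ℂ} {lam : ℝ}

lemma intervalIntegral_gegenbauerWeight_mul_chebyshevU (lam : ℝ) (k m : ℕ) (a : ℂ) :
    ∫ x in (-1 : ℝ)..1, ((gegenbauerWeight lam x * gegenbauerC lam k x : ℝ) : ℂ) *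
      (a * ((Chebyshev.U ℝ m).eval x : ℝ)) =
    a * ((ascPochhammer ℝ k).eval (2 * lam) / k.factorial * chebyshevMoment lam k m : ℝ) := by
  have hint (x : ℝ) : ((gegenbauerWeight lam x * gegenbauerC lam k x : ℝ) : ℂ) *
      (a * ((Chebyshev.U ℝ m).eval x : ℝ)) =
      a * ((ascPochhammer ℝ k).eval (2 * lam) / k.factorial *
        (gegenbauerWeight lam x * (gegenbauerPoly lam k * Chebyshev.U ℝ m).eval x) : ℝ) := by
    rw [gegenbauerC_eq_eval_gegenbauerPoly, eval_mul]
    push_cast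
    ring
  simp only [hint]
  rw [intervalIntegral.integral_const_mul, intervalIntegral.integral_ofReal,
    intervalIntegral.integral_const_mul, chebyshevMoment, weightedInt]

lemma intervalIntegrable_gegenbauerWeight_mul_gegenbauerC (hlam : -(1 / 2) < lam) (k : ℕ) :
    IntervalIntegrable (fun x => gegenbauerWeight lam x * gegenbauerC lam k x) volume (-1) 1 := by
  simp only [gegenbauerC_eq_eval_gegenbauerPoly, mul_left_comm (gegenbauerWeight lam _)]
  exact (intervalIntegrable_gegenbauerWeight_mul_eval hlam _).const_mul _

lemma hasSum_gegenbauerCoeff (hlam : -(1 / 2) < lam) (hlam0 : lam ≠ 0) {b : ℕ → ℂ}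
    (hb : Summable fun m => ‖b m‖ * (m + 1))
    (hf : ∀ x : ℝ, |x| ≤ 1 → HasSum (fun m : ℕ => b m * ((Chebyshev.U ℝ m).eval x : ℝ)) (f x))
    (k : ℕ) :
    HasSum (fun j => gegenbauerConnection lam k *
      ((ordinaryHypergeometricCoefficient (k + 1 : ℝ) (1 - lam) (k + lam + 1) j : ℝ) *
        b (k + 2 * j))) (gegenbauerCoeff f lam k) := by
  have habs : ∀ x ∈ Set.uIoc (-1 : ℝ) 1, |x| ≤ 1 := fun x hx => by
    rw [Set.uIoc_of_le (by norm_num)] at hx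
    exact abs_le.2 ⟨hx.1.le, hx.2⟩
  have hw := intervalIntegrable_gegenbauerWeight_mul_gegenbauerC hlam k
  have hwc : IntervalIntegrable
      (fun x => ((gegenbauerWeight lam x * gegenbauerC lam k x : ℝ) : ℂ)) volume (-1) 1 :=
    ⟨hw.1.ofReal, hw.2.ofReal⟩
  have h := hasSum_intervalIntegral_mul hwc
    (F := fun m x => b m * ((Chebyshev.U ℝ m).eval x : ℝ)) (f := fun x : ℝ => f x)
    (fun m => continuous_const.mul (Complex.continuous_ofReal.comp (Chebyshev.U ℝ m).continuous))
    (fun m x hx => by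
      rw [norm_mul, Complex.norm_real]
      exact mul_le_mul_of_nonneg_left (abs_eval_chebyshevU_le (habs x hx) m) (norm_nonneg _))
    hb (fun x hx => hf x (habs x hx))
  simp only [intervalIntegral_gegenbauerWeight_mul_chebyshevU] at h
  have hinj : Function.Injective fun j : ℕ => k + 2 * j := fun i j hij => by
    simpa using hij
  -- Only the moments of `U_{k + 2j}` survive.
  rw [← hinj.hasSum_iff fun m hm => by
    rw [chebyshevMoment_eq_zero hlam fun j hj => hm ⟨j, hj.symm⟩, mul_zero, Complex.ofReal_zero,
      mul_zero]] at h
  refine (h.mul_left (1 / (gegenbauerH lam k : ℂ))).congr_fun fun j => ?_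
  rw [Function.comp_apply, chebyshevMoment_add_two_mul hlam,
    ← chebyshevMoment_self_div_gegenbauerH hlam hlam0]
  push_cast
  ring

lemma summable_norm_bernsteinIntegral_mul {ρ : ℝ} (hρ : 1 < ρ)
    (hf : ContinuousOn f (bernsteinEllipse ρ)) :
    Summable fun m : ℕ => ‖bernsteinIntegral f ρ (fun u => u⁻¹ ^ (m + 1))‖ * (m + 1) := by
  have hr : ‖ρ⁻¹‖ < 1 := by
    rw [norm_inv, Real.norm_of_nonneg (by linarith)]
    exact inv_lt_one_of_one_lt₀ hρ
  have hgeom : Summable fun m : ℕ => ((m + 1 : ℕ) : ℝ) ^ 1 * ρ⁻¹ ^ (m + 1) :=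
    (summable_nat_add_iff (f := fun m : ℕ => (m : ℝ) ^ 1 * ρ⁻¹ ^ m) 1).2
      (summable_pow_mul_geometric_of_norm_lt_one 1 hr)
  refine .of_nonneg_of_le (fun m => by positivity) (fun m => ?_)
    (hgeom.mul_left (bernsteinMax f ρ * bernsteinLength ρ / Real.pi))
  have h := norm_bernsteinIntegral_le (zero_lt_one.trans hρ) hf (φ := fun u => u⁻¹ ^ (m + 1))
    (C := ρ⁻¹ ^ (m + 1)) fun u hu => by rw [norm_pow, norm_inv, hu]
  calc _ ≤ bernsteinMax f ρ * bernsteinLength ρ / Real.pi * ρ⁻¹ ^ (m + 1) * (m + 1) := by gcongr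
    _ = _ := by
      push_cast
      ring

variable {ρ : ℝ} (hρ : 1 < ρ)
include hρ

lemma norm_inv_sq_lt_one {u : ℂ} (hu : ‖u‖ = ρ) : ‖u⁻¹ ^ 2‖ < 1 := by
  rw [norm_pow, norm_inv, hu]
  exact pow_lt_one₀ (by positivity) (inv_lt_one_of_one_lt₀ hρ) two_ne_zero

lemma hasSum_coefficient_mul_bernsteinIntegral (hf : ContinuousOn f (bernsteinEllipse ρ))
    (a b c : ℝ) (k : ℕ) :
    HasSum (fun j => (ordinaryHypergeometricCoefficient a b c j : ℝ) *
        bernsteinIntegral f ρ (fun u => u⁻¹ ^ (k + 2 * j + 1)))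
      (bernsteinIntegral f ρ fun u => u⁻¹ ^ (k + 1) * ordinaryHypergeometric a b c (u⁻¹ ^ 2)) := by
  have hρ0 : 0 < ρ := by linarith
  simp only [← bernsteinIntegral_const_mul]
  refine hasSum_bernsteinIntegral hρ0 hf (B := fun j =>
    ρ⁻¹ ^ (k + 1) * (‖ordinaryHypergeometricCoefficient a b c j‖ * (ρ⁻¹ ^ 2) ^ j)) ?_ ?_ ?_ ?_
  · exact fun j => continuousOn_const.mul ((continuousOn_id.inv₀ fun u hu =>
      ne_zero_of_mem_sphere hρ0.ne' ⟨u, hu⟩).pow _)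
  · intro j u hu
    rw [norm_mul, norm_pow, norm_inv, hu, Complex.norm_real]
    exact le_of_eq (by ring)
  · exact (summable_norm_ordinaryHypergeometricCoefficient_mul_pow a b c (sq_nonneg ρ⁻¹)
      (pow_lt_one₀ (by positivity) (inv_lt_one_of_one_lt₀ hρ) two_ne_zero)).mul_left _
  · intro u hu
    refine ((hasSum_ordinaryHypergeometric a b c (norm_inv_sq_lt_one hρ hu)).mul_left
      (u⁻¹ ^ (k + 1))).congr_fun fun j => ?_
    rw [Complex.real_smul]
    ring

variable (hf : AnalyticOnNhd ℂ f (bernsteinInterior ρ))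
  (hfc : ContinuousOn f (bernsteinInterior ρ ∪ bernsteinEllipse ρ))
  (hlam : -(1 / 2) < lam) (hlam0 : lam ≠ 0)
include hf hfc hlam hlam0

lemma gegenbauerCoeff_eq_bernsteinIntegral (k : ℕ) :
    gegenbauerCoeff f lam k = gegenbauerConnection lam k * bernsteinIntegral f ρ fun u =>
      u⁻¹ ^ (k + 1) * ordinaryHypergeometric (k + 1 : ℝ) (1 - lam) (k + lam + 1) (u⁻¹ ^ 2) :=
  have hfE := hfc.mono Set.subset_union_right
  (hasSum_gegenbauerCoeff hlam hlam0 (summable_norm_bernsteinIntegral_mul hρ hfE)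
    (fun _ hx => hasSum_bernsteinIntegral_mul_chebyshevU hρ hf hfc hx) k).unique
    ((hasSum_coefficient_mul_bernsteinIntegral hρ hfE _ _ _ k).mul_left _)

lemma norm_gegenbauerCoeff_le (k : ℕ) :
    ‖gegenbauerCoeff f lam k‖ ≤ |gegenbauerConnection lam k| *
      (bernsteinMax f ρ * bernsteinLength ρ / Real.pi *
        (ρ⁻¹ ^ (k + 1) * hypergeometricBound lam (1 / ρ ^ 2))) := by
  rw [gegenbauerCoeff_eq_bernsteinIntegral hρ hf hfc hlam hlam0, norm_mul, Complex.norm_real,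
    Real.norm_eq_abs]
  refine mul_le_mul_of_nonneg_left (norm_bernsteinIntegral_le (zero_lt_one.trans hρ)
    (hfc.mono Set.subset_union_right) fun u hu => ?_) (abs_nonneg _)
  have h := norm_ordinaryHypergeometric_le_hypergeometricBound hlam hlam0 k
    (norm_inv_sq_lt_one hρ hu)
  have hnorm : ‖u⁻¹ ^ 2‖ = 1 / ρ ^ 2 := by rw [norm_pow, norm_inv, hu, inv_pow, one_div]
  rw [hnorm] at h
  rw [norm_mul, norm_pow, norm_inv, hu]
  gcongr

end GegenbauerCoefficients

lemma hypergeometricBound_nonneg {lam r : ℝ} (hlam : -1 < lam) (hr0 : 0 ≤ r) (hr1 : r ≤ 1) :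
    0 ≤ hypergeometricBound lam r := by
  rw [hypergeometricBound]
  split_ifs with hneg
  · have h1 := Real.Gamma_pos_of_pos (show 0 < 1 + lam by linarith)
    have h2 := Real.Gamma_pos_of_pos (show 0 < 1 - 2 * lam by linarith)
    have h3 := Real.Gamma_pos_of_pos (show 0 < 1 - lam by linarith)
    positivity
  all_goals positivity

lemma norm_gegenbauerCoeff_le_gegenbauerD_mul {f : ℂ → ℂ} {ρ lam : ℝ} (hρ : 1 < ρ)
    (hf : AnalyticOnNhd ℂ f (bernsteinInterior ρ))
    (hfc : ContinuousOn f (bernsteinInterior ρ ∪ bernsteinEllipse ρ))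
    (hlam : -(1 / 2) < lam) (hlam0 : lam ≠ 0) {k : ℕ} {B : ℝ}
    (hB : |gegenbauerConnection lam k| ≤ gegenbauerConnectionFactor lam * B) :
    ‖gegenbauerCoeff f lam k‖ ≤ gegenbauerD f lam ρ * (B / ρ ^ k) := by
  have hρ0 : 0 < ρ := zero_lt_one.trans hρ
  have hM := bernsteinMax_nonneg hρ0 (hfc.mono Set.subset_union_right)
  have hL := bernsteinLength_nonneg ρ
  have hH : 0 ≤ hypergeometricBound lam (1 / ρ ^ 2) :=
    hypergeometricBound_nonneg (by linarith) (by positivity)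
      (div_le_one_of_le₀ (one_le_pow₀ hρ.le) (by positivity))
  refine (norm_gegenbauerCoeff_le hρ hf hfc hlam hlam0 k).trans
    ((mul_le_mul_of_nonneg_right hB (by positivity)).trans_eq ?_)
  rw [gegenbauerD_eq, inv_pow, pow_succ]
  field_simp

theorem theorem4p1 (f : ℂ → ℂ) (ρ lam : ℝ) (hρ : 1 < ρ)
    (hf : AnalyticOnNhd ℂ f (bernsteinInterior ρ))
    (hfc : ContinuousOn f (bernsteinInterior ρ ∪ bernsteinEllipse ρ))
    (hlam : -(1 / 2) < lam) (hlam0 : lam ≠ 0) :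
    ‖gegenbauerCoeff f lam 0‖ ≤ gegenbauerD f lam ρ * gegenbauerZeroFactor lam ∧
    ∀ k : ℕ, 1 ≤ k →
      ‖gegenbauerCoeff f lam k‖ ≤ gegenbauerD f lam ρ * ((k : ℝ) ^ (1 - lam) / ρ ^ k) := by
  have hlam1 : -1 < lam := by linarith
  constructor
  · have hzero : |gegenbauerConnection lam 0| ≤
        gegenbauerConnectionFactor lam * gegenbauerZeroFactor lam := by
      rw [gegenbauerConnection_zero hlam1 hlam0, abs_one,
        gegenbauerConnectionFactor_mul_gegenbauerZeroFactor hlam1 hlam0]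
    simpa only [pow_zero, div_one] using
      norm_gegenbauerCoeff_le_gegenbauerD_mul hρ hf hfc hlam hlam0 hzero
  · exact fun k hk => norm_gegenbauerCoeff_le_gegenbauerD_mul hρ hf hfc hlam hlam0
      (abs_gegenbauerConnection_le hlam hlam0 hk)
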